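/- Let $V, V_1 \in L^\infty(\mathbb{R})$ be real-valued functions of compact support, and let $(V_\lambda)_{\lambda>0}$ be real-valued functions in $L^\infty(\mathbb{R})$ such that, for some $\ell$ and all sufficiently small $\lambda>0$, $V_\lambda$ vanishes outside $[-\ell,\ell]$, and $\|V_\lambda - V - \lambda V_1\|_{L_2(\mathbb{R})} = o(\lambda)$ as $\lambda \to 0^+$. Suppose that $\int_{\mathbb{R}} V\,dx < 0$. Then for all sufficiently small $\lambda>0$ the operator $H_\lambda = -\frac{d^2}{dx^2} + \lambda V_\lambda$ in $L_2(\mathbb{R})$ with domain $W_2^2(\mathbb{R})$ has a negative eigenvalue $e_\lambda$ such that $$e_\lambda = -\lambda^2\bigl(\omega_0 + \lambda\omega_1 + o(\lambda)\bigr)^2 \quad\text{as } \lambda\to 0^+,$$ where $$\omega_0 = \frac12\int_{\mathbb{R}} V\,dx, \qquad \omega_1 = \frac14\iint_{\mathbb{R}^2} V(x)\,|x-y|\,V(y)\,dx\,dy + \frac12\int_{\mathbb{R}} V_1\,dx.$$ If moreover $V_\lambda = V$ for all sufficiently small $\lambda > 0$, then this asymptotic formula coincides with the Abarbanel–Callan–Goldberger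 formula: a real-valued function $\lambda\mapsto e_\lambda$ satisfies it if and only if $$\sqrt{-e_\lambda} = -\frac{\lambda}{2}\int_{\mathbb{R}} V\,dx - \frac{\lambda^2}{4}\iint_{\mathbb{R}^2} V(x)\,|x-y|\,V(y)\,dx\,dy + o(\lambda^2) \quad\text{as } \lambda\to 0^+$$ (which includes that $e_\lambda\le 0$ for small $\lambda>0$). -/

import Mathlib

open MeasureTheory Filter Topology Asymptotics
open scoped ENNReal ContDiff

noncomputable section

namespace WeakCoupling

/-- The complex Hilbert space `L₂(ℝ)`. -/
abbrev L2 : Type := Lp ℂ 2 (volume : Measure ℝ)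

/-- The space `L^∞(ℝ)` of real-valued (classes of) essentially bounded functions. -/
abbrev LInf : Type := Lp ℝ ∞ (volume : Measure ℝ)

/-- `g ∈ L₂(ℝ)` is the weak (distributional) derivative of `f ∈ L₂(ℝ)`. -/
def HasWeakDeriv (f g : L2) : Prop :=
  ∀ φ : ℝ → ℝ, ContDiff ℝ ∞ φ → HasCompactSupport φ →
    ∫ x, deriv φ x • f x = -∫ x, φ x • g x

theorem integrable_test_smul (φ : ℝ → ℝ) (hφ : Continuous φ) (hs : HasCompactSupport φ)
    (f : L2) : Integrable (fun x => φ x • f x) volume := by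
  have h : LocallyIntegrable (f : ℝ → ℂ) volume :=
    (Lp.memLp f).locallyIntegrable (by norm_num)
  exact h.integrable_smul_left_of_hasCompactSupport hφ hs

theorem integrable_deriv_test_smul (φ : ℝ → ℝ) (hφ : ContDiff ℝ ∞ φ)
    (hs : HasCompactSupport φ) (f : L2) :
    Integrable (fun x => deriv φ x • f x) volume :=
  integrable_test_smul _ (hφ.continuous_deriv (by simp)) hs.deriv f

theorem HasWeakDeriv.add {f₁ g₁ f₂ g₂ : L2} (h₁ : HasWeakDeriv f₁ g₁)
    (h₂ : HasWeakDeriv f₂ g₂) : HasWeakDeriv (f₁ + f₂) (g₁ + g₂) := by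
  intro φ hφ hs
  have e1 : ∫ x, deriv φ x • (f₁ + f₂ : L2) x
      = ∫ x, (deriv φ x • f₁ x + deriv φ x • f₂ x) := by
    refine integral_congr_ae ?_
    filter_upwards [Lp.coeFn_add f₁ f₂] with x hx
    rw [hx, Pi.add_apply, smul_add]
  have e2 : ∫ x, φ x • (g₁ + g₂ : L2) x = ∫ x, (φ x • g₁ x + φ x • g₂ x) := by
    refine integral_congr_ae ?_
    filter_upwards [Lp.coeFn_add g₁ g₂] with x hx
    rw [hx, Pi.add_apply, smul_add]
  rw [e1, e2, integral_add (integrable_deriv_test_smul φ hφ hs f₁)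
    (integrable_deriv_test_smul φ hφ hs f₂),
    integral_add (integrable_test_smul φ hφ.continuous hs g₁)
    (integrable_test_smul φ hφ.continuous hs g₂), h₁ φ hφ hs, h₂ φ hφ hs, neg_add]

theorem HasWeakDeriv.smul (c : ℂ) {f g : L2} (h : HasWeakDeriv f g) :
    HasWeakDeriv (c • f) (c • g) := by
  intro φ hφ hs
  have e1 : ∫ x, deriv φ x • (c • f : L2) x = ∫ x, c • (deriv φ x • f x) := by
    refine integral_congr_ae ?_
    filter_upwards [Lp.coeFn_smul c f] with x hx
    rw [hx, Pi.smul_apply, smul_comm]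
  have e2 : ∫ x, φ x • (c • g : L2) x = ∫ x, c • (φ x • g x) := by
    refine integral_congr_ae ?_
    filter_upwards [Lp.coeFn_smul c g] with x hx
    rw [hx, Pi.smul_apply, smul_comm]
  rw [e1, e2, integral_smul, integral_smul, h φ hφ hs, smul_neg]

theorem HasWeakDeriv.zero : HasWeakDeriv 0 0 := by
  simpa using HasWeakDeriv.smul 0 (f := 0) (g := 0) (fun φ _ _ => by
    have e (ψ : ℝ → ℝ) : ∫ x, ψ x • (0 : L2) x = 0 := by
      rw [integral_eq_zero_of_ae]
      filter_upwards [Lp.coeFn_zero ℂ 2 (volume : Measure ℝ)] with x hx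
      rw [hx]; simp
    rw [e, e, neg_zero])

theorem HasWeakDeriv.unique {f g₁ g₂ : L2} (h₁ : HasWeakDeriv f g₁)
    (h₂ : HasWeakDeriv f g₂) : g₁ = g₂ := by
  have hl (g : L2) : LocallyIntegrable (g : ℝ → ℂ) volume :=
    (Lp.memLp g).locallyIntegrable (by norm_num)
  refine Lp.ext ?_
  refine ae_eq_of_integral_contDiff_smul_eq (hl g₁) (hl g₂) fun φ hφ hs => ?_
  exact neg_injective ((h₁ φ hφ hs).symm.trans (h₂ φ hφ hs))

/-- The Sobolev space `W₂²(ℝ)`: the functions of `L₂(ℝ)` whose first and second weak derivatives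
belong to `L₂(ℝ)`. -/
def W22 : Submodule ℂ L2 where
  carrier := {f | ∃ g h : L2, HasWeakDeriv f g ∧ HasWeakDeriv g h}
  add_mem' := by
    rintro _ _ ⟨g₁, h₁, a₁, b₁⟩ ⟨g₂, h₂, a₂, b₂⟩
    exact ⟨g₁ + g₂, h₁ + h₂, a₁.add a₂, b₁.add b₂⟩
  zero_mem' := ⟨0, 0, HasWeakDeriv.zero, HasWeakDeriv.zero⟩
  smul_mem' := by
    rintro c _ ⟨g, h, a, b⟩
    exact ⟨c • g, c • h, a.smul c, b.smul c⟩

/-- `h` is the second weak derivative of `f`. -/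
def HasWeakDeriv₂ (f h : L2) : Prop := ∃ g : L2, HasWeakDeriv f g ∧ HasWeakDeriv g h

theorem HasWeakDeriv₂.unique {f h₁ h₂ : L2} (a : HasWeakDeriv₂ f h₁)
    (b : HasWeakDeriv₂ f h₂) : h₁ = h₂ := by
  obtain ⟨g₁, a₁, b₁⟩ := a
  obtain ⟨g₂, a₂, b₂⟩ := b
  obtain rfl := a₁.unique a₂
  exact b₁.unique b₂

theorem exists_hasWeakDeriv₂ (f : W22) : ∃ h : L2, HasWeakDeriv₂ f h := by
  obtain ⟨g, h, a, b⟩ := f.2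
  exact ⟨h, g, a, b⟩

/-- The second derivative `f ↦ f''` as a linear map `W₂²(ℝ) → L₂(ℝ)`. -/
def secondDeriv : W22 →ₗ[ℂ] L2 where
  toFun f := (exists_hasWeakDeriv₂ f).choose
  map_add' f₁ f₂ := by
    obtain ⟨g₁, a₁, b₁⟩ := (exists_hasWeakDeriv₂ f₁).choose_spec
    obtain ⟨g₂, a₂, b₂⟩ := (exists_hasWeakDeriv₂ f₂).choose_spec
    exact (exists_hasWeakDeriv₂ (f₁ + f₂)).choose_spec.unique ⟨g₁ + g₂, a₁.add a₂, b₁.add b₂⟩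
  map_smul' c f := by
    obtain ⟨g, a, b⟩ := (exists_hasWeakDeriv₂ f).choose_spec
    exact (exists_hasWeakDeriv₂ (c • f)).choose_spec.unique ⟨c • g, a.smul c, b.smul c⟩

theorem secondDeriv_spec (f : W22) : HasWeakDeriv₂ f (secondDeriv f) :=
  (exists_hasWeakDeriv₂ f).choose_spec

/-- Multiplication by a bounded real potential `q`, as an operator in `L₂(ℝ)`. -/
def mulOp (q : LInf) : L2 →ₗ[ℂ] L2 where
  toFun f := (q • f : L2)
  map_add' f g := Lp.add_smul q f g
  map_smul' c f := by
    refine Lp.ext ?_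
    filter_upwards [Lp.coeFn_lpSMul (r := 2) q (c • f), Lp.coeFn_smul c f,
      Lp.coeFn_smul c (q • f : L2), Lp.coeFn_lpSMul (r := 2) q f] with x h1 h2 h3 h4
    simp only [RingHom.id_apply]
    rw [h1, h3, Pi.smul_apply', h2, Pi.smul_apply, Pi.smul_apply, h4, Pi.smul_apply', smul_comm]

/-- The Schrödinger operator `-d²/dx² + q` in `L₂(ℝ)` with domain `W₂²(ℝ)`. -/
def schrodinger (q : LInf) : L2 →ₗ.[ℂ] L2 where
  domain := W22
  toFun := -secondDeriv + (mulOp q).comp W22.subtype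

/-- `μ` is an eigenvalue of the (unbounded) operator `A`. -/
def IsEigenvalue (A : L2 →ₗ.[ℂ] L2) (μ : ℂ) : Prop :=
  ∃ ψ : A.domain, ψ ≠ 0 ∧ A ψ = μ • (ψ : L2)

/-- `q` vanishes (almost everywhere) outside `[-ℓ, ℓ]`. -/
def SupportedIn (q : LInf) (ℓ : ℝ) : Prop := ∀ᵐ x : ℝ, ℓ < |x| → q x = 0

/-- The double integral `∬ V(x) |x - y| V(y) dx dy`. -/
def doubleIntegral (V : LInf) : ℝ := ∫ p : ℝ × ℝ, V p.1 * |p.1 - p.2| * V p.2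

/-- `ω₀ = ½ ∫ V`. -/
def omega0 (V : LInf) : ℝ := (1 / 2) * ∫ x, V x

/-- `ω₁ = ¼ ∬ V(x) |x - y| V(y) dx dy + ½ ∫ V₁`. -/
def omega1 (V V₁ : LInf) : ℝ := (1 / 4) * doubleIntegral V + (1 / 2) * ∫ x, V₁ x

/-- `e lam = -lam² (ω₀ + lam ω₁ + o(lam))²` as `lam → 0+`. -/
def HasThresholdExpansion (e : ℝ → ℝ) (ω₀ ω₁ : ℝ) : Prop :=
  ∃ r : ℝ → ℝ, r =o[𝓝[>] 0] (fun lam : ℝ => lam) ∧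
    ∀ᶠ lam in 𝓝[>] (0 : ℝ), e lam = -lam ^ 2 * (ω₀ + lam * ω₁ + r lam) ^ 2

/-- The Abarbanel–Callan–Goldberger formula
`√(-e lam) = -(lam/2) ∫ V - (lam²/4) ∬ V(x) |x - y| V(y) dx dy + o(lam²)` as `lam → 0+`. -/
def HasACGExpansion (e : ℝ → ℝ) (V : LInf) : Prop :=
  (fun lam : ℝ => Real.sqrt (-e lam)
      - (-(lam / 2) * (∫ x, V x) - (lam ^ 2 / 4) * doubleIntegral V))
    =o[𝓝[>] 0] (fun lam : ℝ => lam ^ 2)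

end WeakCoupling

end

noncomputable section

open scoped BoundedContinuousFunction

namespace WeakCoupling

/-! Write q = λ V_λ. An eigenfunction at energy -κ² with κ > 0 satisfies ψ = -(2κ)⁻¹ ∫ e^{-κ|x-y|} q
ψ dy, and all the singularity at κ = 0 sits in a rank-one part: e^{-κt}/(2κ) = 1/(2κ) + G_κ(t),
where G_κ(t) = (e^{-κt} - 1)/(2κ) stays regular and G_0(t) = -t/2. Normalising the rank-one term to
1 turns the equation into the coupled system κ = -½ ∫ qψ, ψ = 1 - ∫ G_κ(|x-y|) q ψ dy.

Substituting the first equation into the second gives a nonlinear fixed-point problem on bounded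
continuous functions, which is a contraction near ψ = 1 once ‖q‖₁ is small
(`exists_reduced_solution`). To have bounds for every κ and all x, y, the kernel is frozen at G_0
for κ ≤ 0 and |x-y| is truncated to the support interval. Neither change matters in the end: q
vanishes outside that interval, and the condition ∫ V < 0 forces κ > 0 for small λ.

Inserting ψ ≈ 1 and G_κ ≈ G_0 gives κ = -½ ∫ q - ¼ ∬ q|x-y|q + O(‖q‖₁³) (`exists_momentum`).
Expanding q in λ yields ω₀ and ω₁ (`abs_born_sub_le`), the L₂ error being converted to an L₁ error
on a bounded interval. Conversely a solution with κ > 0 produces a genuine L₂ eigenfunction by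
convolution with e^{-κ|x|} (`isEigenvalue_of_reduced`).

The equivalence with the square-root formula is a matter of signs, since ω₀ < 0 determines the
branch of the root (`hasThresholdExpansion_iff`). -/

/-! ### The reduced equation as a contraction. -/

theorem abs_integral_mul_le {f v : ℝ → ℝ} {C : ℝ} (hv : Integrable v) (hf : ∀ y, |f y| ≤ C) :
    |∫ y, f y * v y| ≤ C * ∫ y, |v y| := by
  rw [← integral_const_mul, ← Real.norm_eq_abs]
  refine norm_integral_le_of_norm_le (hv.abs.const_mul C) (Eventually.of_forall fun y => ?_)
  rw [Real.norm_eq_abs, abs_mul]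
  exact mul_le_mul_of_nonneg_right (hf y) (abs_nonneg _)

theorem integrable_mul_bcf {v : ℝ → ℝ} (hv : Integrable v) (ψ : ℝ →ᵇ ℝ) :
    Integrable fun y => v y * ψ y :=
  hv.mul_bdd ψ.continuous.aestronglyMeasurable (Eventually.of_forall ψ.norm_coe_le_norm)

theorem integral_abs_mul_bcf_le {v : ℝ → ℝ} (hv : Integrable v) (ψ : ℝ →ᵇ ℝ) :
    ∫ y, |v y * ψ y| ≤ (∫ y, |v y|) * ‖ψ‖ := by
  rw [← integral_mul_const]
  refine integral_mono (integrable_mul_bcf hv ψ).abs (hv.abs.mul_const _) fun y => ?_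
  simp only [abs_mul]
  exact mul_le_mul_of_nonneg_left (ψ.norm_coe_le_norm y) (abs_nonneg _)

section FixedPoint

variable {v : ℝ → ℝ} {k : ℝ → ℝ → ℝ → ℝ} {B L : ℝ}

theorem integrable_kernel_mul {w : ℝ → ℝ} (hw : Integrable w)
    (hk : ∀ κ, Continuous (Function.uncurry (k κ))) (hB : ∀ κ x y, |k κ x y| ≤ B) (κ x : ℝ) :
    Integrable fun y => k κ x y * w y :=
  hw.bdd_mul ((hk κ).comp (Continuous.prodMk_right x)).aestronglyMeasurable
    (Eventually.of_forall (hB κ x))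

theorem continuous_integral_kernel_mul {w : ℝ → ℝ} (hw : Integrable w)
    (hk : ∀ κ, Continuous (Function.uncurry (k κ))) (hB : ∀ κ x y, |k κ x y| ≤ B) (κ : ℝ) :
    Continuous fun x => ∫ y, k κ x y * w y := by
  refine continuous_of_dominated (bound := fun y => B * |w y|)
    (fun x => (integrable_kernel_mul hw hk hB κ x).1) (fun x => Eventually.of_forall fun y => ?_)
    (hw.abs.const_mul B) (Eventually.of_forall fun y => ?_)
  · rw [Real.norm_eq_abs, abs_mul]
    exact mul_le_mul_of_nonneg_right (hB κ x y) (abs_nonneg _)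
  · exact ((hk κ).comp (Continuous.prodMk_left y)).mul continuous_const

/-- The nonlinear map whose fixed points solve the reduced eigenvalue equation. -/
def reducedMap (hv : Integrable v) (hk : ∀ κ, Continuous (Function.uncurry (k κ)))
    (hB : ∀ κ x y, |k κ x y| ≤ B) (ψ : ℝ →ᵇ ℝ) : ℝ →ᵇ ℝ :=
  BoundedContinuousFunction.ofNormedAddCommGroup
    (fun x => 1 - ∫ y, k (-(1 / 2) * ∫ z, v z * ψ z) x y * (v y * ψ y))
    (continuous_const.sub (continuous_integral_kernel_mul (integrable_mul_bcf hv ψ) hk hB _))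
    (1 + B * ∫ y, |v y * ψ y|) fun x => by
      refine (norm_sub_le _ _).trans (add_le_add (by simp) ?_)
      exact abs_integral_mul_le (integrable_mul_bcf hv ψ) (hB _ x)

theorem reducedMap_apply (hv : Integrable v) (hk : ∀ κ, Continuous (Function.uncurry (k κ)))
    (hB : ∀ κ x y, |k κ x y| ≤ B) (ψ : ℝ →ᵇ ℝ) (x : ℝ) :
    reducedMap hv hk hB ψ x = 1 - ∫ y, k (-(1 / 2) * ∫ z, v z * ψ z) x y * (v y * ψ y) := rfl

theorem norm_reducedMap_sub_one_le (hv : Integrable v)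
    (hk : ∀ κ, Continuous (Function.uncurry (k κ))) (hB : ∀ κ x y, |k κ x y| ≤ B) (hB0 : 0 ≤ B)
    {ψ : ℝ →ᵇ ℝ} (hψ : ‖ψ‖ ≤ 2) : ‖reducedMap hv hk hB ψ - 1‖ ≤ 2 * B * ∫ y, |v y| := by
  have hN : 0 ≤ ∫ y, |v y| := integral_nonneg fun _ => abs_nonneg _
  refine (BoundedContinuousFunction.norm_le (by positivity)).2 fun x => ?_
  have e : (reducedMap hv hk hB ψ - 1 : ℝ →ᵇ ℝ) x
      = -∫ y, k (-(1 / 2) * ∫ z, v z * ψ z) x y * (v y * ψ y) := by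
    rw [BoundedContinuousFunction.sub_apply, reducedMap_apply]
    simp
  rw [e, norm_neg]
  calc _ ≤ B * ∫ y, |v y * ψ y| := abs_integral_mul_le (integrable_mul_bcf hv ψ) (hB _ x)
    _ ≤ B * ((∫ y, |v y|) * 2) := by
      refine mul_le_mul_of_nonneg_left ((integral_abs_mul_bcf_le hv ψ).trans ?_) hB0
      exact mul_le_mul_of_nonneg_left hψ hN
    _ = _ := by ring

/-- The function enters both linearly and through κ. Changing it under a fixed kernel costs B‖v‖₁;
changing κ by at most ½‖v‖₁‖ψ - χ‖ costs L times that, times ‖vχ‖₁ ≤ 2‖v‖₁. -/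
theorem norm_reducedMap_sub_le (hv : Integrable v)
    (hk : ∀ κ, Continuous (Function.uncurry (k κ))) (hB : ∀ κ x y, |k κ x y| ≤ B) (hB0 : 0 ≤ B)
    (hL0 : 0 ≤ L) (hL : ∀ κ κ' x y, |k κ x y - k κ' x y| ≤ L * |κ - κ'|)
    {ψ χ : ℝ →ᵇ ℝ} (hχ : ‖χ‖ ≤ 2) :
    ‖reducedMap hv hk hB ψ - reducedMap hv hk hB χ‖
      ≤ (B * (∫ y, |v y|) + L * (∫ y, |v y|) ^ 2) * ‖ψ - χ‖ := by
  have hN : 0 ≤ ∫ y, |v y| := integral_nonneg fun _ => abs_nonneg _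
  have hψi := integrable_mul_bcf hv ψ
  have hχi := integrable_mul_bcf hv χ
  have hdi := integrable_mul_bcf hv (ψ - χ)
  have hd : ∀ y, v y * ψ y - v y * χ y = v y * (ψ - χ : ℝ →ᵇ ℝ) y := fun y => by
    rw [BoundedContinuousFunction.sub_apply, mul_sub]
  refine (BoundedContinuousFunction.norm_le (by positivity)).2 fun x => ?_
  rw [BoundedContinuousFunction.sub_apply, reducedMap_apply, reducedMap_apply]
  set κ := -(1 / 2) * ∫ z, v z * ψ z with hκ
  set κ' := -(1 / 2) * ∫ z, v z * χ z with hκ'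
  have hκκ : |κ - κ'| ≤ 1 / 2 * ((∫ y, |v y|) * ‖ψ - χ‖) := by
    have e : κ - κ' = -(1 / 2) * ∫ z, v z * (ψ - χ : ℝ →ᵇ ℝ) z := by
      rw [hκ, hκ', ← mul_sub, ← integral_sub hψi hχi]
      simp only [hd]
    rw [e, abs_mul, abs_neg, abs_of_pos (by norm_num : (0 : ℝ) < 1 / 2)]
    exact mul_le_mul_of_nonneg_left
      (abs_integral_le_integral_abs.trans (integral_abs_mul_bcf_le hv _)) (by norm_num)
  have e : (1 - ∫ y, k κ x y * (v y * ψ y)) - (1 - ∫ y, k κ' x y * (v y * χ y))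
      = -((∫ y, k κ x y * (v y * (ψ - χ : ℝ →ᵇ ℝ) y))
        + ∫ y, (k κ x y - k κ' x y) * (v y * χ y)) := by
    have i1 := integrable_kernel_mul hψi hk hB κ x
    have i2 := integrable_kernel_mul hχi hk hB κ x
    have i3 := integrable_kernel_mul hχi hk hB κ' x
    simp only [← hd, mul_sub, sub_mul]
    rw [integral_sub i1 i2, integral_sub i2 i3]
    ring
  rw [e, norm_neg]
  refine (norm_add_le _ _).trans ?_
  have h1 : ‖∫ y, k κ x y * (v y * (ψ - χ : ℝ →ᵇ ℝ) y)‖ ≤ B * ((∫ y, |v y|) * ‖ψ - χ‖) :=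
    (abs_integral_mul_le hdi (hB κ x)).trans
      (mul_le_mul_of_nonneg_left (integral_abs_mul_bcf_le hv _) hB0)
  have h2 : ‖∫ y, (k κ x y - k κ' x y) * (v y * χ y)‖
      ≤ L * (1 / 2 * ((∫ y, |v y|) * ‖ψ - χ‖)) * ((∫ y, |v y|) * 2) :=
    (abs_integral_mul_le hχi fun y =>
      (hL κ κ' x y).trans (mul_le_mul_of_nonneg_left hκκ hL0)).trans
      (mul_le_mul_of_nonneg_left ((integral_abs_mul_bcf_le hv χ).trans
        (mul_le_mul_of_nonneg_left hχ hN)) (by positivity))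
  exact (add_le_add h1 h2).trans (le_of_eq (by ring))

theorem exists_reduced_solution (hv : Integrable v)
    (hk : ∀ κ, Continuous (Function.uncurry (k κ))) (hB : ∀ κ x y, |k κ x y| ≤ B) (hB0 : 0 ≤ B)
    (hL0 : 0 ≤ L) (hL : ∀ κ κ' x y, |k κ x y - k κ' x y| ≤ L * |κ - κ'|)
    (h1 : 2 * B * ∫ y, |v y| ≤ 1) (h2 : B * (∫ y, |v y|) + L * (∫ y, |v y|) ^ 2 < 1) :
    ∃ ψ : ℝ →ᵇ ℝ, ‖ψ‖ ≤ 2 ∧ ‖ψ - 1‖ ≤ 2 * B * (∫ y, |v y|) ∧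
      ∀ x, ψ x = 1 - ∫ y, k (-(1 / 2) * ∫ z, v z * ψ z) x y * (v y * ψ y) := by
  have hN : 0 ≤ ∫ y, |v y| := integral_nonneg fun _ => abs_nonneg _
  -- The contraction lives on the unit ball around the constant 1, the solution for v = 0; `h1`
  -- makes this ball invariant.
  have hball : ∀ ψ ∈ Metric.closedBall (1 : ℝ →ᵇ ℝ) 1, ‖ψ‖ ≤ 2 := fun ψ hψ => by
    rw [mem_closedBall_iff_norm] at hψ
    have h3 : ‖ψ‖ ≤ ‖ψ - 1‖ + ‖(1 : ℝ →ᵇ ℝ)‖ := by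
      simpa using norm_add_le (ψ - 1) (1 : ℝ →ᵇ ℝ)
    rw [norm_one] at h3
    linarith
  have hmaps : Set.MapsTo (reducedMap hv hk hB) (Metric.closedBall 1 1) (Metric.closedBall 1 1) :=
    fun ψ hψ => mem_closedBall_iff_norm.2
      ((norm_reducedMap_sub_one_le hv hk hB hB0 (hball ψ hψ)).trans h1)
  have hc : ContractingWith ⟨B * (∫ y, |v y|) + L * (∫ y, |v y|) ^ 2, by positivity⟩
      (Set.MapsTo.restrict (reducedMap hv hk hB) _ _ hmaps) := by
    refine ⟨by exact_mod_cast h2, LipschitzWith.of_dist_le_mul fun ψ χ => ?_⟩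
    rw [Subtype.dist_eq, Subtype.dist_eq, dist_eq_norm, dist_eq_norm]
    exact norm_reducedMap_sub_le hv hk hB hB0 hL0 hL (hball _ χ.2)
  obtain ⟨ψ, hψ, hfix, -⟩ := hc.exists_fixedPoint' Metric.isClosed_closedBall.isComplete hmaps
    (Metric.mem_closedBall_self zero_le_one) (edist_ne_top _ _)
  refine ⟨ψ, hball ψ hψ, ?_, fun x => ?_⟩
  · have := norm_reducedMap_sub_one_le hv hk hB hB0 (hball ψ hψ)
    rwa [hfix] at this
  · rw [← reducedMap_apply hv hk hB, hfix]

end FixedPoint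

/-! ### Truncated distance and the Green kernel with its pole removed. -/

/-- The projection of `x` to `[-ℓ, ℓ]`. -/
def clamp (ℓ x : ℝ) : ℝ := max (-ℓ) (min ℓ x)

theorem continuous_clamp (ℓ : ℝ) : Continuous (clamp ℓ) := by
  unfold clamp; fun_prop

theorem abs_clamp_le {ℓ : ℝ} (hℓ : 0 ≤ ℓ) (x : ℝ) : |clamp ℓ x| ≤ ℓ :=
  abs_le.2 ⟨le_max_left _ _, max_le (by linarith) (min_le_left _ _)⟩

theorem clamp_eq_self {ℓ x : ℝ} (hx : |x| ≤ ℓ) : clamp ℓ x = x := by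
  rw [clamp, min_eq_right (abs_le.1 hx).2, max_eq_right (abs_le.1 hx).1]

/-- The distance of the projections of `x` and `y` to `[-ℓ, ℓ]`. -/
def clampDist (ℓ x y : ℝ) : ℝ := |clamp ℓ x - clamp ℓ y|

theorem continuous_clampDist (ℓ : ℝ) : Continuous (Function.uncurry (clampDist ℓ)) := by
  have := continuous_clamp ℓ
  simp only [Function.uncurry_def, clampDist]
  fun_prop

theorem clampDist_nonneg (ℓ x y : ℝ) : 0 ≤ clampDist ℓ x y := abs_nonneg _

theorem clampDist_le {ℓ : ℝ} (hℓ : 0 ≤ ℓ) (x y : ℝ) : clampDist ℓ x y ≤ 2 * ℓ := by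
  refine (abs_sub _ _).trans ?_
  linarith [abs_clamp_le hℓ x, abs_clamp_le hℓ y]

/-- `(exp (-κ t) - 1) / (2 κ)` for `κ > 0`, extended by `-t / 2` to `κ ≤ 0`. -/
def reducedGreen (κ t : ℝ) : ℝ := -(1 / 2) * ∫ s in 0..t, Real.exp (-(max κ 0 * s))

theorem continuous_exp_neg_mul (κ : ℝ) : Continuous fun s : ℝ => Real.exp (-(κ * s)) := by
  fun_prop

theorem reducedGreen_zero (t : ℝ) : reducedGreen 0 t = -(1 / 2) * t := by
  simp [reducedGreen]

theorem reducedGreen_of_pos {κ : ℝ} (hκ : 0 < κ) (t : ℝ) :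
    reducedGreen κ t = (Real.exp (-(κ * t)) - 1) / (2 * κ) := by
  have h : ∫ s in 0..t, Real.exp (-(κ * s)) = -(κ⁻¹ * Real.exp (-(κ * t))) + κ⁻¹ := by
    rw [intervalIntegral.integral_eq_sub_of_hasDerivAt
      (f := fun s => -(κ⁻¹ * Real.exp (-(κ * s)))) (fun s _ => ?_)
      ((continuous_exp_neg_mul κ).intervalIntegrable _ _)]
    · simp
    · have h1 : HasDerivAt (fun s : ℝ => -(κ * s)) (-κ) s := by
        simpa using ((hasDerivAt_id s).const_mul κ).fun_neg
      refine (h1.exp.const_mul κ⁻¹).fun_neg.congr_deriv ?_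
      rw [mul_neg, mul_neg, neg_neg, mul_comm _ κ, inv_mul_cancel_left₀ hκ.ne']
  rw [reducedGreen, max_eq_left hκ.le, h]
  field_simp
  ring

theorem continuous_reducedGreen (κ : ℝ) : Continuous (reducedGreen κ) :=
  continuous_const.mul (intervalIntegral.continuous_primitive
    (fun _ _ => (continuous_exp_neg_mul (max κ 0)).intervalIntegrable _ _) 0)

/-- The integral form avoids dividing by κ: with `max κ 0` in the exponent the integrand is at most
1, so the bound is uniform in κ. -/
theorem abs_reducedGreen_le (κ : ℝ) {t : ℝ} (ht : 0 ≤ t) : |reducedGreen κ t| ≤ t / 2 := by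
  have h : ‖∫ s in 0..t, Real.exp (-(max κ 0 * s))‖ ≤ 1 * |t - 0| := by
    refine intervalIntegral.norm_integral_le_of_norm_le_const fun s hs => ?_
    rw [Set.uIoc_of_le ht] at hs
    rw [Real.norm_eq_abs, Real.abs_exp, Real.exp_le_one_iff]
    have := mul_nonneg (le_max_right κ 0) hs.1.le
    linarith
  rw [sub_zero, abs_of_nonneg ht, Real.norm_eq_abs] at h
  rw [reducedGreen, abs_mul, abs_neg, abs_of_pos (by norm_num : (0 : ℝ) < 1 / 2)]
  linarith

theorem abs_exp_neg_sub_exp_neg_le {a b : ℝ} (ha : 0 ≤ a) (hb : 0 ≤ b) :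
    |Real.exp (-a) - Real.exp (-b)| ≤ |a - b| := by
  wlog hab : a ≤ b generalizing a b
  · rw [abs_sub_comm, abs_sub_comm a]
    exact this hb ha (le_of_not_ge hab)
  have h1 : Real.exp (-b) = Real.exp (-a) * Real.exp (-(b - a)) := by
    rw [← Real.exp_add]; ring_nf
  have h2 := Real.one_sub_le_exp_neg (b - a)
  have h3 : Real.exp (-a) ≤ 1 := Real.exp_le_one_iff.2 (by linarith)
  have h4 : Real.exp (-b) ≤ Real.exp (-a) := Real.exp_le_exp.2 (by linarith)
  rw [abs_of_nonneg (by linarith), abs_of_nonpos (by linarith)]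
  nlinarith [Real.exp_pos (-a)]

/-- Both s ↦ e^{-s} on s ≥ 0 and κ ↦ max κ 0 are 1-Lipschitz, so the integrands differ by at most
t|κ - κ'| on (0, t]. -/
theorem abs_reducedGreen_sub_le (κ κ' : ℝ) {t : ℝ} (ht : 0 ≤ t) :
    |reducedGreen κ t - reducedGreen κ' t| ≤ t ^ 2 / 2 * |κ - κ'| := by
  have h : ‖∫ s in 0..t, (Real.exp (-(max κ 0 * s)) - Real.exp (-(max κ' 0 * s)))‖
      ≤ |κ - κ'| * t * |t - 0| := by
    refine intervalIntegral.norm_integral_le_of_norm_le_const fun s hs => ?_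
    rw [Set.uIoc_of_le ht] at hs
    refine (abs_exp_neg_sub_exp_neg_le (mul_nonneg (le_max_right κ 0) hs.1.le)
      (mul_nonneg (le_max_right κ' 0) hs.1.le)).trans ?_
    rw [← sub_mul, abs_mul, abs_of_pos hs.1]
    exact mul_le_mul (abs_max_sub_max_le_abs κ κ' 0) hs.2 hs.1.le (abs_nonneg _)
  rw [intervalIntegral.integral_sub ((continuous_exp_neg_mul _).intervalIntegrable _ _)
    ((continuous_exp_neg_mul _).intervalIntegrable _ _), sub_zero, abs_of_nonneg ht,
    Real.norm_eq_abs] at h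
  rw [reducedGreen, reducedGreen, ← mul_sub, abs_mul, abs_neg,
    abs_of_pos (by norm_num : (0 : ℝ) < 1 / 2)]
  linarith

/-! ### The momentum κ and its second-order expansion. -/

/-- The double integral of `v(x) |x - y| v(y)`, with the distance truncated to `[-ℓ, ℓ]`. -/
def clampEnergy (ℓ : ℝ) (v : ℝ → ℝ) : ℝ := ∫ x, (∫ y, clampDist ℓ x y * v y) * v x

theorem exists_momentum {ℓ : ℝ} (hℓ : 0 ≤ ℓ) {v : ℝ → ℝ} (hv : Integrable v)
    (h1 : 2 * ℓ * ∫ y, |v y| ≤ 1)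
    (h2 : ℓ * (∫ y, |v y|) + 2 * ℓ ^ 2 * (∫ y, |v y|) ^ 2 < 1) :
    ∃ (κ : ℝ) (ψ : ℝ →ᵇ ℝ), κ = -(1 / 2) * (∫ y, v y * ψ y) ∧
      (∀ x, ψ x = 1 - ∫ y, reducedGreen κ (clampDist ℓ x y) * (v y * ψ y)) ∧
      |κ + 1 / 2 * (∫ y, v y) + 1 / 4 * clampEnergy ℓ v| ≤ 4 * ℓ ^ 2 * (∫ y, |v y|) ^ 3 := by
  have hN : 0 ≤ ∫ y, |v y| := integral_nonneg fun _ => abs_nonneg _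
  have hk : ∀ κ, Continuous (Function.uncurry fun x y => reducedGreen κ (clampDist ℓ x y)) :=
    fun κ => (continuous_reducedGreen κ).comp (continuous_clampDist ℓ)
  have hB : ∀ κ x y, |reducedGreen κ (clampDist ℓ x y)| ≤ ℓ := fun κ x y =>
    (abs_reducedGreen_le κ (clampDist_nonneg ℓ x y)).trans (by linarith [clampDist_le hℓ x y])
  have hL : ∀ κ κ' x y, |reducedGreen κ (clampDist ℓ x y) - reducedGreen κ' (clampDist ℓ x y)|
      ≤ 2 * ℓ ^ 2 * |κ - κ'| := fun κ κ' x y =>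
    (abs_reducedGreen_sub_le κ κ' (clampDist_nonneg ℓ x y)).trans
      (mul_le_mul_of_nonneg_right
        (by nlinarith [clampDist_le hℓ x y, clampDist_nonneg ℓ x y]) (abs_nonneg _))
  obtain ⟨ψ, hψ2, hψ1, hψ⟩ := exists_reduced_solution
    (k := fun κ x y => reducedGreen κ (clampDist ℓ x y)) hv hk hB hℓ (by positivity) hL h1 h2
  refine ⟨_, ψ, rfl, hψ, ?_⟩
  set κ := -(1 / 2) * ∫ y, v y * ψ y with hκ
  have hψi := integrable_mul_bcf hv ψ
  have hdi := integrable_mul_bcf hv (ψ - 1)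
  have hκN : |κ| ≤ ∫ y, |v y| := by
    rw [hκ, abs_mul, abs_neg, abs_of_pos (by norm_num : (0 : ℝ) < 1 / 2)]
    have h3 := (abs_integral_le_integral_abs (f := fun y => v y * ψ y)).trans
      (integral_abs_mul_bcf_le hv ψ)
    nlinarith
  -- Replacing G_κ by G_0 costs 2ℓ²|κ|·2‖v‖₁ ≤ 4ℓ²‖v‖₁², and replacing ψ by 1 costs ℓ‖v‖₁·2ℓ‖v‖₁;
  -- together these give the 6.
  have hbound : ∀ x, |(∫ y, reducedGreen κ (clampDist ℓ x y) * (v y * ψ y))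
      + 1 / 2 * ∫ y, clampDist ℓ x y * v y| ≤ 6 * ℓ ^ 2 * (∫ y, |v y|) ^ 2 := fun x => by
    have hD : ∀ y, clampDist ℓ x y = -2 * reducedGreen 0 (clampDist ℓ x y) := fun y => by
      rw [reducedGreen_zero]; ring
    have e : (∫ y, reducedGreen κ (clampDist ℓ x y) * (v y * ψ y))
        + 1 / 2 * ∫ y, clampDist ℓ x y * v y
        = (∫ y, (reducedGreen κ (clampDist ℓ x y) - reducedGreen 0 (clampDist ℓ x y))
            * (v y * ψ y))
          + ∫ y, reducedGreen 0 (clampDist ℓ x y) * (v y * (ψ - 1 : ℝ →ᵇ ℝ) y) := by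
      have i1 := integrable_kernel_mul hψi hk hB κ x
      have i2 := integrable_kernel_mul hψi hk hB 0 x
      have i3 := integrable_kernel_mul hv hk hB 0 x
      have e1 : ∫ y, clampDist ℓ x y * v y
          = -2 * ∫ y, reducedGreen 0 (clampDist ℓ x y) * v y := by
        rw [← integral_const_mul]
        refine integral_congr_ae (Eventually.of_forall fun y => ?_)
        change clampDist ℓ x y * v y = -2 * (reducedGreen 0 (clampDist ℓ x y) * v y)
        rw [← mul_assoc, ← hD]
      simp only [BoundedContinuousFunction.sub_apply, BoundedContinuousFunction.coe_one,
        Pi.one_apply, mul_sub, sub_mul, mul_one]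
      rw [integral_sub i1 i2, integral_sub i2 i3, e1]
      ring
    rw [e]
    refine (abs_add_le _ _).trans ?_
    have b1 := (abs_integral_mul_le hψi fun y => (hL κ 0 x y)).trans
      (mul_le_mul_of_nonneg_left ((integral_abs_mul_bcf_le hv ψ).trans
        (mul_le_mul_of_nonneg_left hψ2 hN)) (by positivity))
    have b2 := (abs_integral_mul_le hdi (hB 0 x)).trans
      (mul_le_mul_of_nonneg_left ((integral_abs_mul_bcf_le hv (ψ - 1)).trans
        (mul_le_mul_of_nonneg_left hψ1 hN)) hℓ)
    rw [sub_zero] at b1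
    have b3 : 2 * ℓ ^ 2 * |κ| * ((∫ y, |v y|) * 2)
        ≤ 2 * ℓ ^ 2 * (∫ y, |v y|) * ((∫ y, |v y|) * 2) :=
      mul_le_mul_of_nonneg_right (mul_le_mul_of_nonneg_left hκN (by positivity)) (by positivity)
    refine (add_le_add (b1.trans b3) b2).trans (le_of_eq ?_)
    ring
  have hG : ∀ x, ψ x * v x = v x - (∫ y, reducedGreen κ (clampDist ℓ x y) * (v y * ψ y)) * v x :=
    fun x => by rw [hψ x]; ring
  have iG : Integrable fun x => (∫ y, reducedGreen κ (clampDist ℓ x y) * (v y * ψ y)) * v x :=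
    hv.bdd_mul (continuous_integral_kernel_mul
        (k := fun κ x y => reducedGreen κ (clampDist ℓ x y)) hψi hk hB κ).aestronglyMeasurable
      (Eventually.of_forall fun x => abs_integral_mul_le hψi (hB κ x))
  have iD : Integrable fun x => (∫ y, clampDist ℓ x y * v y) * v x :=
    hv.bdd_mul (continuous_integral_kernel_mul (k := fun _ => clampDist ℓ) (B := 2 * ℓ) hv
        (fun _ => continuous_clampDist ℓ) (fun _ x y => by
          rw [abs_of_nonneg (clampDist_nonneg ℓ x y)]; exact clampDist_le hℓ x y)
        0).aestronglyMeasurable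
      (Eventually.of_forall fun x => abs_integral_mul_le hv (fun y => by
          rw [abs_of_nonneg (clampDist_nonneg ℓ x y)]; exact clampDist_le hℓ x y))
  -- One substitution of the equation for ψ into κ = -½ ∫ vψ isolates the first two Born terms
  -- exactly; the rest is controlled by `hbound`.
  have e : κ + 1 / 2 * (∫ y, v y) + 1 / 4 * clampEnergy ℓ v
      = 1 / 2 * ∫ x, ((∫ y, reducedGreen κ (clampDist ℓ x y) * (v y * ψ y))
          + 1 / 2 * ∫ y, clampDist ℓ x y * v y) * v x := by
    have e1 : ∫ y, v y * ψ y = (∫ y, v y)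
        - ∫ x, (∫ y, reducedGreen κ (clampDist ℓ x y) * (v y * ψ y)) * v x := by
      rw [← integral_sub hv iG]
      exact integral_congr_ae (Eventually.of_forall fun x => (mul_comm _ _).trans (hG x))
    simp only [add_mul, mul_assoc (1 / 2 : ℝ)]
    rw [integral_add iG (iD.const_mul _), integral_const_mul, clampEnergy]
    linarith
  rw [e, abs_mul, abs_of_pos (by norm_num : (0 : ℝ) < 1 / 2)]
  have := abs_integral_mul_le hv hbound
  nlinarith [pow_nonneg hN 3, mul_nonneg (sq_nonneg ℓ) (pow_nonneg hN 3)]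

/-! ### Exponential kernels: weak derivatives and decay. -/

/-- The even exponential kernel `exp (-κ |z|)`. -/
def evenExp (κ z : ℝ) : ℝ := Real.exp (-(κ * |z|))

/-- The odd exponential kernel `sgn z exp (-κ |z|)`. -/
def oddExp (κ z : ℝ) : ℝ := if 0 < z then Real.exp (-(κ * |z|)) else -Real.exp (-(κ * |z|))

theorem measurable_evenExp (κ : ℝ) : Measurable (evenExp κ) := by
  unfold evenExp; fun_prop

theorem measurable_oddExp (κ : ℝ) : Measurable (oddExp κ) := by
  have h := measurable_evenExp κ
  exact Measurable.ite measurableSet_Ioi h h.neg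

theorem abs_evenExp_le (κ z : ℝ) : |evenExp κ z| ≤ Real.exp (-(κ * |z|)) := by
  rw [evenExp, Real.abs_exp]

theorem abs_oddExp_le (κ z : ℝ) : |oddExp κ z| ≤ Real.exp (-(κ * |z|)) := by
  unfold oddExp
  split_ifs <;> simp

/-- The fundamental theorem of calculus for φ(x) e^{c(x-y)} on each half-line. Taking c = -κ on the
right and c = κ on the left covers both kernels. -/
theorem integral_Ioi_deriv_mul_exp {φ : ℝ → ℝ} (hφ : ContDiff ℝ ∞ φ) (hs : HasCompactSupport φ)
    (c y : ℝ) : (∫ x in Set.Ioi y, deriv φ x * Real.exp (c * (x - y)))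
      + c * (∫ x in Set.Ioi y, φ x * Real.exp (c * (x - y))) = -φ y ∧
    (∫ x in Set.Iic y, deriv φ x * Real.exp (c * (x - y)))
      + c * (∫ x in Set.Iic y, φ x * Real.exp (c * (x - y))) = φ y := by
  have hE : ContDiff ℝ ∞ fun x : ℝ => Real.exp (c * (x - y)) := by fun_prop
  have hF : ContDiff ℝ 1 fun x => φ x * Real.exp (c * (x - y)) :=
    (hφ.mul hE).of_le (by exact_mod_cast le_top)
  have hFs : HasCompactSupport fun x => φ x * Real.exp (c * (x - y)) := hs.mul_right
  have hd : deriv (fun x => φ x * Real.exp (c * (x - y)))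
      = fun x => deriv φ x * Real.exp (c * (x - y)) + c * (φ x * Real.exp (c * (x - y))) := by
    funext x
    have h1 : HasDerivAt (fun x : ℝ => c * (x - y)) c x := by
      simpa using ((hasDerivAt_id x).sub_const y).const_mul c
    have h2 := ((hφ.differentiable (by simp)) x).hasDerivAt.fun_mul h1.exp
    rw [h2.deriv]
    ring
  have i1 : Integrable fun x => deriv φ x * Real.exp (c * (x - y)) :=
    ((hφ.continuous_deriv (by simp)).mul hE.continuous).integrable_of_hasCompactSupport
      hs.deriv.mul_right
  have i2 : Integrable fun x => c * (φ x * Real.exp (c * (x - y))) :=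
    (hF.continuous.integrable_of_hasCompactSupport hFs).const_mul c
  constructor
  · have := hFs.integral_Ioi_deriv_eq hF y
    rw [hd, integral_add i1.integrableOn i2.integrableOn, integral_const_mul] at this
    simpa using this
  · have := hFs.integral_Iic_deriv_eq hF y
    rw [hd, integral_add i1.integrableOn i2.integrableOn, integral_const_mul] at this
    simpa using this

theorem integrable_mul_kernel_sub {φ K : ℝ → ℝ} {κ : ℝ} (hκ : 0 ≤ κ) (hφ : Integrable φ)
    (hK : Measurable K) (hb : ∀ z, |K z| ≤ Real.exp (-(κ * |z|))) (y : ℝ) :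
    Integrable fun x => φ x * K (x - y) :=
  hφ.mul_bdd (hK.comp (measurable_id.sub_const y)).aestronglyMeasurable (c := 1)
    (Eventually.of_forall fun x => (hb _).trans (Real.exp_le_one_iff.2
      (by have := mul_nonneg hκ (abs_nonneg (x - y)); linarith)))

theorem setIntegral_Ioi_evenExp (φ : ℝ → ℝ) (κ y : ℝ) :
    ∫ x in Set.Ioi y, φ x * evenExp κ (x - y)
      = ∫ x in Set.Ioi y, φ x * Real.exp (-κ * (x - y)) :=
  setIntegral_congr_fun measurableSet_Ioi fun x hx => by
    have : 0 < x - y := sub_pos.2 hx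
    simp only [evenExp, abs_of_pos this, neg_mul]

theorem setIntegral_Iic_evenExp (φ : ℝ → ℝ) (κ y : ℝ) :
    ∫ x in Set.Iic y, φ x * evenExp κ (x - y)
      = ∫ x in Set.Iic y, φ x * Real.exp (κ * (x - y)) :=
  setIntegral_congr_fun measurableSet_Iic fun x hx => by
    have : x - y ≤ 0 := sub_nonpos.2 hx
    simp only [evenExp, abs_of_nonpos this, mul_neg, neg_neg]

theorem setIntegral_Ioi_oddExp (φ : ℝ → ℝ) (κ y : ℝ) :
    ∫ x in Set.Ioi y, φ x * oddExp κ (x - y)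
      = ∫ x in Set.Ioi y, φ x * Real.exp (-κ * (x - y)) :=
  setIntegral_congr_fun measurableSet_Ioi fun x hx => by
    have : 0 < x - y := sub_pos.2 hx
    simp only [oddExp, if_pos this, abs_of_pos this, neg_mul]

/-- The odd kernel takes the value -1 at 0, so the integrands agree pointwise on the closed
half-line. -/
theorem setIntegral_Iic_oddExp (φ : ℝ → ℝ) (κ y : ℝ) :
    ∫ x in Set.Iic y, φ x * oddExp κ (x - y)
      = -∫ x in Set.Iic y, φ x * Real.exp (κ * (x - y)) := by
  rw [← integral_neg]
  refine setIntegral_congr_fun measurableSet_Iic fun x hx => ?_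
  have : x - y ≤ 0 := sub_nonpos.2 hx
  simp only [oddExp, if_neg this.not_gt, abs_of_nonpos this, mul_neg, neg_neg]

theorem integral_eq_Iic_add_Ioi {f : ℝ → ℝ} (hf : Integrable f) (y : ℝ) :
    ∫ x, f x = (∫ x in Set.Iic y, f x) + ∫ x in Set.Ioi y, f x :=
  (intervalIntegral.integral_Iic_add_Ioi hf.integrableOn hf.integrableOn).symm

theorem integral_deriv_mul_evenExp {φ : ℝ → ℝ} (hφ : ContDiff ℝ ∞ φ) (hs : HasCompactSupport φ)
    {κ : ℝ} (hκ : 0 ≤ κ) (y : ℝ) :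
    ∫ x, deriv φ x * evenExp κ (x - y) = κ * ∫ x, φ x * oddExp κ (x - y) := by
  have hi := hφ.continuous.integrable_of_hasCompactSupport (μ := volume) hs
  have hdi := (hφ.continuous_deriv (by simp)).integrable_of_hasCompactSupport (μ := volume)
    hs.deriv
  rw [integral_eq_Iic_add_Ioi (integrable_mul_kernel_sub hκ hdi (measurable_evenExp κ)
      (abs_evenExp_le κ) y) y,
    integral_eq_Iic_add_Ioi (integrable_mul_kernel_sub hκ hi (measurable_oddExp κ)
      (abs_oddExp_le κ) y) y,
    setIntegral_Ioi_evenExp, setIntegral_Iic_evenExp, setIntegral_Ioi_oddExp,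
    setIntegral_Iic_oddExp]
  linarith [(integral_Ioi_deriv_mul_exp hφ hs (-κ) y).1, (integral_Ioi_deriv_mul_exp hφ hs κ y).2]

/-- The term -2φ(y) comes from the jump of height 2 at x = y. It is the delta function that makes
e^{-κ|x|}/(2κ) a fundamental solution of -d²/dx² + κ². -/
theorem integral_deriv_mul_oddExp {φ : ℝ → ℝ} (hφ : ContDiff ℝ ∞ φ) (hs : HasCompactSupport φ)
    {κ : ℝ} (hκ : 0 ≤ κ) (y : ℝ) :
    ∫ x, deriv φ x * oddExp κ (x - y) = -2 * φ y + κ * ∫ x, φ x * evenExp κ (x - y) := by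
  have hi := hφ.continuous.integrable_of_hasCompactSupport (μ := volume) hs
  have hdi := (hφ.continuous_deriv (by simp)).integrable_of_hasCompactSupport (μ := volume)
    hs.deriv
  rw [integral_eq_Iic_add_Ioi (integrable_mul_kernel_sub hκ hi (measurable_evenExp κ)
      (abs_evenExp_le κ) y) y,
    integral_eq_Iic_add_Ioi (integrable_mul_kernel_sub hκ hdi (measurable_oddExp κ)
      (abs_oddExp_le κ) y) y,
    setIntegral_Ioi_evenExp, setIntegral_Iic_evenExp, setIntegral_Ioi_oddExp,
    setIntegral_Iic_oddExp]
  linarith [(integral_Ioi_deriv_mul_exp hφ hs (-κ) y).1, (integral_Ioi_deriv_mul_exp hφ hs κ y).2]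

/-- Fubini, legitimate because the kernel is bounded by 1. It moves the weak derivative of a
convolution onto the kernel. -/
theorem integral_mul_integral_kernel {φ g K : ℝ → ℝ} {κ : ℝ} (hκ : 0 ≤ κ) (hφ : Integrable φ)
    (hg : Integrable g) (hK : Measurable K) (hb : ∀ z, |K z| ≤ Real.exp (-(κ * |z|))) :
    ∫ x, φ x * ∫ y, K (x - y) * g y = ∫ y, g y * ∫ x, φ x * K (x - y) := by
  have hi : Integrable (Function.uncurry fun x y => φ x * (K (x - y) * g y))
      (volume.prod volume) := by
    have h1 : Integrable (fun p : ℝ × ℝ => K (p.1 - p.2) * (φ p.1 * g p.2))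
        (volume.prod volume) :=
      (hφ.mul_prod hg).bdd_mul (c := 1)
        (hK.comp (measurable_fst.sub measurable_snd)).aestronglyMeasurable
        (Eventually.of_forall fun p => (hb _).trans (Real.exp_le_one_iff.2
          (by have := mul_nonneg hκ (abs_nonneg (p.1 - p.2)); linarith)))
    refine h1.congr (Eventually.of_forall fun p => ?_)
    simp only [Function.uncurry]
    ring
  have h2 := integral_integral_swap hi
  simp only [integral_const_mul] at h2
  rw [h2]
  refine integral_congr_ae (Eventually.of_forall fun y => ?_)
  simp only [← integral_const_mul]
  refine integral_congr_ae (Eventually.of_forall fun x => ?_)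
  simp only
  ring

theorem integrable_exp_neg_mul_abs {c : ℝ} (hc : 0 < c) :
    Integrable fun x : ℝ => Real.exp (-(c * |x|)) := by
  have h1 : IntegrableOn (fun x : ℝ => Real.exp (-(c * |x|))) (Set.Ioi 0) :=
    (exp_neg_integrableOn_Ioi 0 hc).congr_fun (fun x hx => by
      simp only [abs_of_pos (Set.mem_Ioi.1 hx), neg_mul]) measurableSet_Ioi
  have h2 : IntegrableOn (fun x : ℝ => Real.exp (-(c * |x|))) (Set.Iic 0) := by
    rw [integrableOn_Iic_iff_integrableOn_Iio]
    have h3 := h1.comp_neg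
    simpa using h3
  rw [← integrableOn_univ, ← Set.Iic_union_Ioi (a := (0 : ℝ))]
  exact h2.union h1

theorem memLp_exp_neg_mul_abs {c : ℝ} (hc : 0 < c) :
    MemLp (fun x : ℝ => Real.exp (-(c * |x|))) 2 volume := by
  refine (memLp_two_iff_integrable_sq (by fun_prop)).2 ?_
  refine (integrable_exp_neg_mul_abs (mul_pos two_pos hc)).congr (Eventually.of_forall fun x => ?_)
  simp only [← Real.exp_nat_mul]
  congr 1
  push_cast
  ring

theorem memLp_integral_kernel {g K : ℝ → ℝ} {κ ℓ : ℝ} (hκ : 0 < κ)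
    (hg : Integrable g) (hs : ∀ᵐ y, ℓ < |y| → g y = 0) (hK : Measurable K)
    (hb : ∀ z, |K z| ≤ Real.exp (-(κ * |z|))) :
    MemLp (fun x => ∫ y, K (x - y) * g y) 2 volume := by
  -- A measurable representative of g is needed for joint measurability of the integrand.
  obtain ⟨g', hg'm, hgg'⟩ := hg.1
  have hm : StronglyMeasurable fun x => ∫ y, K (x - y) * g y := by
    have e : (fun x => ∫ y, K (x - y) * g y) = fun x => ∫ y, K (x - y) * g' y := by
      funext x
      refine integral_congr_ae ?_
      filter_upwards [hgg'] with y hy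
      rw [hy]
    rw [e]
    refine StronglyMeasurable.integral_prod_right (f := fun x y => K (x - y) * g' y) ?_
    exact ((hK.comp (measurable_fst.sub measurable_snd)).mul
      (hg'm.measurable.comp measurable_snd)).stronglyMeasurable
  refine ((memLp_exp_neg_mul_abs hκ).const_mul (Real.exp (κ * ℓ) * ∫ y, |g y|)).of_le
    hm.aestronglyMeasurable (Eventually.of_forall fun x => ?_)
  have h1 : ‖∫ y, K (x - y) * g y‖ ≤ ∫ y, Real.exp (κ * ℓ) * Real.exp (-(κ * |x|)) * |g y| := by
    refine norm_integral_le_of_norm_le (hg.abs.const_mul _) ?_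
    filter_upwards [hs] with y hy
    rw [Real.norm_eq_abs, abs_mul]
    by_cases h : ℓ < |y|
    · simp [hy h]
    · refine mul_le_mul_of_nonneg_right ((hb _).trans ?_) (abs_nonneg _)
      -- On |y| ≤ ℓ one has |x - y| ≥ |x| - ℓ, whence the factor e^{κℓ} and exponential decay in x.
      rw [← Real.exp_add, Real.exp_le_exp]
      have := abs_sub_abs_le_abs_sub x y
      nlinarith
  rw [integral_const_mul] at h1
  refine h1.trans ((le_of_eq ?_).trans (le_abs_self _))
  ring

/-! ### From the reduced equation to an eigenfunction. -/

theorem hasWeakDeriv_toLp {a b : ℝ → ℝ} {f g : L2}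
    (hf : ∀ᵐ x, f x = (a x : ℂ)) (hg : ∀ᵐ x, g x = (b x : ℂ))
    (h : ∀ φ : ℝ → ℝ, ContDiff ℝ ∞ φ → HasCompactSupport φ →
      ∫ x, deriv φ x * a x = -∫ x, φ x * b x) :
    HasWeakDeriv f g := by
  intro φ hφ hs
  have e1 : ∫ x, deriv φ x • f x = ((∫ x, deriv φ x * a x : ℝ) : ℂ) := by
    rw [← integral_complex_ofReal]
    refine integral_congr_ae ?_
    filter_upwards [hf] with x hx
    rw [hx]; simp
  have e2 : ∫ x, φ x • g x = ((∫ x, φ x * b x : ℝ) : ℂ) := by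
    rw [← integral_complex_ofReal]
    refine integral_congr_ae ?_
    filter_upwards [hg] with x hx
    rw [hx]; simp
  rw [e1, e2, h φ hφ hs, Complex.ofReal_neg]

/-- The fixed point ψ need not be in L₂, since truncation distorts it outside the support of q. The
eigenfunction is f = -(2κ)⁻¹ e^{-κ|·|} ∗ (qψ), which decays and agrees with ψ on [-ℓ, ℓ], so that qf
= qψ. -/
theorem isEigenvalue_of_reduced {ℓ κ : ℝ} {q : LInf} (hq : SupportedIn q ℓ)
    (hqi : Integrable q) (hκ : 0 < κ) {ψ : ℝ →ᵇ ℝ} (hκψ : κ = -(1 / 2) * (∫ y, q y * ψ y))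
    (hψ : ∀ x, ψ x = 1 - ∫ y, reducedGreen κ (clampDist ℓ x y) * (q y * ψ y)) :
    IsEigenvalue (schrodinger q) ((-κ ^ 2 : ℝ) : ℂ) := by
  have hg : Integrable fun y => q y * ψ y := integrable_mul_bcf hqi ψ
  have hgs : ∀ᵐ y, ℓ < |y| → q y * ψ y = 0 := by
    filter_upwards [hq] with y hy h
    rw [hy h, zero_mul]
  have hu := memLp_integral_kernel hκ hg hgs (measurable_evenExp κ) (abs_evenExp_le κ)
  have hw := memLp_integral_kernel hκ hg hgs (measurable_oddExp κ) (abs_oddExp_le κ)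
  set u : ℝ → ℝ := fun x => ∫ y, evenExp κ (x - y) * (q y * ψ y)
  set w : ℝ → ℝ := fun x => ∫ y, oddExp κ (x - y) * (q y * ψ y)
  -- For |x|, |y| ≤ ℓ the truncation is inactive and e^{-κ|x-y|} = 2κ G_κ(|x-y|) + 1; the constant 1
  -- contributes ∫ qψ = -2κ.
  have huψ : ∀ x, |x| ≤ ℓ → u x = -(2 * κ) * ψ x := fun x hx => by
    have e : u x = ∫ y, (2 * κ * (reducedGreen κ (clampDist ℓ x y) * (q y * ψ y))
        + q y * ψ y) := by
      refine integral_congr_ae ?_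
      filter_upwards [hgs] with y hy
      by_cases h : ℓ < |y|
      · simp [hy h]
      · rw [clampDist, clamp_eq_self hx, clamp_eq_self (not_lt.1 h), reducedGreen_of_pos hκ,
          evenExp]
        field_simp
        ring
    have iG : Integrable fun y => reducedGreen κ (clampDist ℓ x y) * (q y * ψ y) := by
      have hℓ : 0 ≤ ℓ := (abs_nonneg x).trans hx
      refine integrable_kernel_mul (k := fun κ x y => reducedGreen κ (clampDist ℓ x y)) (B := ℓ) hg
        (fun κ => (continuous_reducedGreen κ).comp (continuous_clampDist ℓ))
        (fun κ x y => (abs_reducedGreen_le κ (clampDist_nonneg ℓ x y)).trans ?_) κ x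
      linarith [clampDist_le hℓ x y]
    rw [e, integral_add (iG.const_mul _) hg, integral_const_mul]
    have := hψ x
    linear_combination (2 * κ) * this + 2 * hκψ
  have hΨ : MemLp (fun x => ((-(2 * κ)⁻¹ * u x : ℝ) : ℂ)) 2 volume := (hu.const_mul _).ofReal
  have hΨ' : MemLp (fun x => ((1 / 2 * w x : ℝ) : ℂ)) 2 volume := (hw.const_mul _).ofReal
  set f : L2 := hΨ.toLp _
  set f₁ : L2 := hΨ'.toLp _
  have hf : ∀ᵐ x, f x = ((-(2 * κ)⁻¹ * u x : ℝ) : ℂ) := hΨ.coeFn_toLp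
  have hf₁ : ∀ᵐ x, f₁ x = ((1 / 2 * w x : ℝ) : ℂ) := hΨ'.coeFn_toLp
  have hqf : ∀ᵐ x, (mulOp q f) x = ((q x * ψ x : ℝ) : ℂ) := by
    filter_upwards [Lp.coeFn_lpSMul (r := 2) q f, hf, hq] with x h1 h2 h3
    change (q • f : L2) x = _
    rw [h1, Pi.smul_apply', h2]
    by_cases h : ℓ < |x|
    · simp [h3 h]
    · have e : -(2 * κ)⁻¹ * (-(2 * κ) * ψ x) = ψ x := by field_simp
      rw [huψ x (not_lt.1 h), e]
      simp
  -- The eigenvalue equation dictates f'' = qf + κ²f; written through u this is what differentiating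
  -- the convolution twice produces.
  have hf₂ : ∀ᵐ x, (mulOp q f + ((κ ^ 2 : ℝ) : ℂ) • f : L2) x
      = ((q x * ψ x - κ / 2 * u x : ℝ) : ℂ) := by
    filter_upwards [Lp.coeFn_add (mulOp q f) (((κ ^ 2 : ℝ) : ℂ) • f),
      Lp.coeFn_smul ((κ ^ 2 : ℝ) : ℂ) f, hf, hqf] with x h1 h2 h3 h4
    rw [h1, Pi.add_apply, h2, Pi.smul_apply, h3, h4, smul_eq_mul, ← Complex.ofReal_mul,
      ← Complex.ofReal_add]
    congr 1
    field_simp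
    ring
  have d₁ : HasWeakDeriv f f₁ := by
    refine hasWeakDeriv_toLp hf hf₁ fun φ hφ hs => ?_
    have hi := hφ.continuous.integrable_of_hasCompactSupport (μ := volume) hs
    have hdi := (hφ.continuous_deriv (by simp)).integrable_of_hasCompactSupport (μ := volume)
      hs.deriv
    simp only [mul_left_comm _ (-(2 * κ)⁻¹), mul_left_comm _ (1 / 2 : ℝ), integral_const_mul]
    rw [integral_mul_integral_kernel hκ.le hdi hg (measurable_evenExp κ) (abs_evenExp_le κ),
      integral_mul_integral_kernel hκ.le hi hg (measurable_oddExp κ) (abs_oddExp_le κ)]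
    simp only [integral_deriv_mul_evenExp hφ hs hκ.le, mul_left_comm _ κ, integral_const_mul]
    field_simp
  have d₂ : HasWeakDeriv f₁ (mulOp q f + ((κ ^ 2 : ℝ) : ℂ) • f) := by
    refine hasWeakDeriv_toLp hf₁ hf₂ fun φ hφ hs => ?_
    have hi := hφ.continuous.integrable_of_hasCompactSupport (μ := volume) hs
    have hdi := (hφ.continuous_deriv (by simp)).integrable_of_hasCompactSupport (μ := volume)
      hs.deriv
    obtain ⟨C, hC⟩ := hφ.continuous.bounded_above_of_compact_support hs
    have iφg : Integrable fun x => φ x * (q x * ψ x) :=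
      hg.bdd_mul hφ.continuous.aestronglyMeasurable (Eventually.of_forall hC)
    have iφu : Integrable fun x => φ x * u x :=
      MemLp.integrable_mul (p := 2) (q := 2) (hφ.continuous.memLp_of_hasCompactSupport hs) hu
    have igφ : Integrable fun y => q y * ψ y * ∫ x, φ x * evenExp κ (x - y) := by
      have hm : AEStronglyMeasurable (fun y => ∫ x, φ x * evenExp κ (x - y)) volume := by
        refine StronglyMeasurable.aestronglyMeasurable ?_
        refine StronglyMeasurable.integral_prod_right (f := fun y x => φ x * evenExp κ (x - y)) ?_
        exact ((hφ.continuous.measurable.comp measurable_snd).mul ((measurable_evenExp κ).comp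
          (measurable_snd.sub measurable_fst))).stronglyMeasurable
      refine hg.mul_bdd hm (c := ∫ x, |φ x|) (Eventually.of_forall fun y => ?_)
      refine norm_integral_le_of_norm_le hi.abs (Eventually.of_forall fun x => ?_)
      rw [Real.norm_eq_abs, abs_mul]
      refine mul_le_of_le_one_right (abs_nonneg _) ((abs_evenExp_le _ _).trans ?_)
      exact Real.exp_le_one_iff.2 (by have := mul_nonneg hκ.le (abs_nonneg (x - y)); linarith)
    have hsum : ∀ y, q y * ψ y * (-2 * φ y + κ * ∫ x, φ x * evenExp κ (x - y))
        = -2 * (φ y * (q y * ψ y)) + κ * (q y * ψ y * ∫ x, φ x * evenExp κ (x - y)) :=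
      fun y => by ring
    simp only [mul_left_comm _ (1 / 2 : ℝ), mul_sub, mul_left_comm _ (κ / 2), integral_const_mul]
    rw [integral_sub iφg (iφu.const_mul _), integral_const_mul,
      integral_mul_integral_kernel hκ.le hdi hg (measurable_oddExp κ) (abs_oddExp_le κ),
      integral_mul_integral_kernel hκ.le hi hg (measurable_evenExp κ) (abs_evenExp_le κ)]
    simp only [integral_deriv_mul_oddExp hφ hs hκ.le, hsum]
    rw [integral_add (iφg.const_mul _) (igφ.const_mul _), integral_const_mul, integral_const_mul]
    ring
  have hdom : f ∈ W22 := ⟨f₁, _, d₁, d₂⟩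
  have hsec : secondDeriv ⟨f, hdom⟩ = mulOp q f + ((κ ^ 2 : ℝ) : ℂ) • f :=
    (secondDeriv_spec ⟨f, hdom⟩).unique ⟨f₁, d₁, d₂⟩
  refine ⟨⟨f, hdom⟩, fun h0 => ?_, ?_⟩
  -- If f vanished then qψ = qf would vanish almost everywhere, forcing κ = -½ ∫ qψ = 0.
  · have hf0 : f = 0 := congrArg Subtype.val h0
    have h1 : ∫ y, q y * ψ y = 0 := by
      refine integral_eq_zero_of_ae ?_
      have h2 : mulOp q f = 0 := by rw [hf0, map_zero]
      filter_upwards [hqf, Lp.coeFn_zero ℂ 2 (volume : Measure ℝ)] with x hx hx0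
      rw [h2, hx0, Pi.zero_apply] at hx
      rw [Pi.zero_apply]
      exact_mod_cast hx.symm
    rw [h1, mul_zero] at hκψ
    exact hκ.ne' hκψ
  · change -secondDeriv ⟨f, hdom⟩ + mulOp q f = _
    rw [hsec]
    change _ = ((-κ ^ 2 : ℝ) : ℂ) • f
    rw [Complex.ofReal_neg, neg_smul]
    abel

/-! ### Compactly supported potentials: norms and the quadratic energy. -/

theorem SupportedIn.mono {q : LInf} {ℓ R : ℝ} (h : SupportedIn q ℓ) (hR : ℓ ≤ R) :
    SupportedIn q R := by
  filter_upwards [h] with x hx h1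
  exact hx (hR.trans_lt h1)

theorem SupportedIn.ae_eq_indicator {q : LInf} {R : ℝ} (h : SupportedIn q R) :
    (q : ℝ → ℝ) =ᵐ[volume] (Set.Icc (-R) R).indicator q := by
  filter_upwards [h] with x hx
  by_cases hxR : x ∈ Set.Icc (-R) R
  · rw [Set.indicator_of_mem hxR]
  · rw [Set.indicator_of_notMem hxR]
    exact hx (not_le.1 fun h => hxR (abs_le.1 h))

theorem SupportedIn.integrable {q : LInf} {R : ℝ} (h : SupportedIn q R) : Integrable q := by
  refine Integrable.congr ?_ h.ae_eq_indicator.symm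
  rw [integrable_indicator_iff measurableSet_Icc]
  exact ((Lp.memLp q).restrict (Set.Icc (-R) R)).integrable le_top

/-- Hölder on the interval [-R, R]: the constant is its length to the power 1 - ½. This transfers L₂
closeness to the L₁ norm used in all later estimates. -/
theorem SupportedIn.integral_abs_le {q : LInf} {R : ℝ} (h : SupportedIn q R) :
    ∫ x, |q x| ≤ (eLpNorm q 2 volume).toReal
      * (volume (Set.Icc (-R) R) ^ (1 / (1 : ℝ≥0∞).toReal - 1 / (2 : ℝ≥0∞).toReal)).toReal := by
  set μ := (volume : Measure ℝ).restrict (Set.Icc (-R) R)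
  have hm : MemLp q 2 μ := ((Lp.memLp q).restrict (Set.Icc (-R) R)).mono_exponent le_top
  have e2 : eLpNorm q 2 volume = eLpNorm q 2 μ := by
    rw [eLpNorm_congr_ae h.ae_eq_indicator, eLpNorm_indicator_eq_eLpNorm_restrict measurableSet_Icc]
  have e1 : eLpNorm q 1 volume = eLpNorm q 1 μ := by
    rw [eLpNorm_congr_ae h.ae_eq_indicator, eLpNorm_indicator_eq_eLpNorm_restrict measurableSet_Icc]
  have h1 : ∫ x, |q x| = (eLpNorm q 1 volume).toReal := by
    have := integral_norm_eq_lintegral_enorm h.integrable.1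
    rw [eLpNorm_one_eq_lintegral_enorm, ← this]
    rfl
  have h2 := eLpNorm_le_eLpNorm_mul_rpow_measure_univ (μ := μ) (p := 1) (q := 2) (by norm_num) hm.1
  rw [Measure.restrict_apply_univ] at h2
  rw [h1, e1, e2, ← ENNReal.toReal_mul]
  refine ENNReal.toReal_mono (ENNReal.mul_ne_top hm.eLpNorm_ne_top ?_) h2
  exact ENNReal.rpow_ne_top_of_nonneg (by norm_num) (by simp)

theorem clampEnergy_congr {R : ℝ} {v w : ℝ → ℝ} (h : v =ᵐ[volume] w) :
    clampEnergy R v = clampEnergy R w := by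
  have e : ∀ x, ∫ y, clampDist R x y * v y = ∫ y, clampDist R x y * w y := fun x => by
    refine integral_congr_ae ?_
    filter_upwards [h] with y hy
    rw [hy]
  refine integral_congr_ae ?_
  filter_upwards [h] with x hx
  rw [hx, e]

theorem abs_clampDist_le {R : ℝ} (hR : 0 ≤ R) (x y : ℝ) : |clampDist R x y| ≤ 2 * R := by
  rw [abs_of_nonneg (clampDist_nonneg R x y)]
  exact clampDist_le hR x y

theorem SupportedIn.doubleIntegral_eq {V : LInf} {R : ℝ} (hR : 0 ≤ R) (h : SupportedIn V R) :
    doubleIntegral V = clampEnergy R V := by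
  have hi := h.integrable
  have e : doubleIntegral V = ∫ p : ℝ × ℝ, clampDist R p.1 p.2 * (V p.1 * V p.2) := by
    refine integral_congr_ae ?_
    filter_upwards [Measure.quasiMeasurePreserving_fst.ae h,
      Measure.quasiMeasurePreserving_snd.ae h] with p h1 h2
    by_cases c1 : R < |p.1|
    · simp [h1 c1]
    by_cases c2 : R < |p.2|
    · simp [h2 c2]
    rw [clampDist, clamp_eq_self (not_lt.1 c1), clamp_eq_self (not_lt.1 c2)]
    ring
  have hp : Integrable (fun p : ℝ × ℝ => clampDist R p.1 p.2 * (V p.1 * V p.2))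
      (volume.prod volume) :=
    (hi.mul_prod hi).bdd_mul (continuous_clampDist R).aestronglyMeasurable
      (Eventually.of_forall fun p => abs_clampDist_le hR p.1 p.2)
  rw [e, Measure.volume_eq_prod, integral_prod _ hp, clampEnergy]
  refine integral_congr_ae (Eventually.of_forall fun x => ?_)
  simp only [mul_left_comm _ (V x), integral_const_mul]
  ring

theorem integrable_clampDist_mul {R : ℝ} (hR : 0 ≤ R) {g : ℝ → ℝ} (hg : Integrable g) (x : ℝ) :
    Integrable fun y => clampDist R x y * g y :=
  integrable_kernel_mul (k := fun _ => clampDist R) hg (fun _ => continuous_clampDist R)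
    (fun _ => abs_clampDist_le hR) 0 x

theorem integrable_integral_clampDist_mul {R : ℝ} (hR : 0 ≤ R) {f g : ℝ → ℝ}
    (hf : Integrable f) (hg : Integrable g) :
    Integrable fun x => (∫ y, clampDist R x y * g y) * f x :=
  hf.bdd_mul (continuous_integral_kernel_mul (k := fun _ => clampDist R) hg
      (fun _ => continuous_clampDist R) (fun _ => abs_clampDist_le hR) 0).aestronglyMeasurable
    (Eventually.of_forall fun x => abs_integral_mul_le hg (abs_clampDist_le hR x))

/-- The energy is a quadratic form with kernel bounded by 2R: two cross terms and one pure term in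
p. -/
theorem abs_clampEnergy_add_sub_le {R : ℝ} (hR : 0 ≤ R) {v p : ℝ → ℝ} (hv : Integrable v)
    (hp : Integrable p) :
    |clampEnergy R (fun x => v x + p x) - clampEnergy R v|
      ≤ 2 * R * (∫ x, |p x|) * (2 * (∫ x, |v x|) + ∫ x, |p x|) := by
  have ivv := integrable_integral_clampDist_mul hR hv hv
  have ivp := integrable_integral_clampDist_mul hR hv hp
  have ipv := integrable_integral_clampDist_mul hR hp hv
  have ipp := integrable_integral_clampDist_mul hR hp hp
  have e : clampEnergy R (fun x => v x + p x) = clampEnergy R v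
      + (∫ x, (∫ y, clampDist R x y * p y) * v x) + (∫ x, (∫ y, clampDist R x y * v y) * p x)
      + ∫ x, (∫ y, clampDist R x y * p y) * p x := by
    have e1 : ∀ x, (∫ y, clampDist R x y * (v y + p y)) * (v x + p x)
        = ((∫ y, clampDist R x y * v y) * v x + (∫ y, clampDist R x y * p y) * v x
          + (∫ y, clampDist R x y * v y) * p x) + (∫ y, clampDist R x y * p y) * p x := fun x => by
      simp only [mul_add (clampDist R x _)]
      rw [integral_add (integrable_clampDist_mul hR hv x) (integrable_clampDist_mul hR hp x)]
      ring
    simp only [clampEnergy, e1]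
    rw [integral_add ((ivv.fun_add ivp).fun_add ipv) ipp, integral_add (ivv.fun_add ivp) ipv,
      integral_add ivv ivp]
  have hb : ∀ {f g : ℝ → ℝ}, Integrable f → Integrable g →
      |∫ x, (∫ y, clampDist R x y * g y) * f x| ≤ 2 * R * (∫ x, |g x|) * ∫ x, |f x| :=
    fun hf hg => abs_integral_mul_le hf fun x => abs_integral_mul_le hg (abs_clampDist_le hR x)
  rw [e]
  have b1 := abs_le.1 (hb hv hp)
  have b2 := abs_le.1 (hb hp hv)
  have b3 := abs_le.1 (hb hp hp)
  rw [abs_le]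
  constructor <;> linarith [b1.1, b1.2, b2.1, b2.2, b3.1, b3.2]

theorem clampEnergy_const_mul (R c : ℝ) (v : ℝ → ℝ) :
    clampEnergy R (fun x => c * v x) = c ^ 2 * clampEnergy R v := by
  have e : ∀ x, (∫ y, clampDist R x y * (c * v y)) * (c * v x)
      = c ^ 2 * ((∫ y, clampDist R x y * v y) * v x) := fun x => by
    simp only [mul_left_comm _ c, integral_const_mul]
    ring
  simp only [clampEnergy, e, integral_const_mul]

/-! ### Expansion in the coupling constant. -/

section Expansion

variable {v v₁ d : ℝ → ℝ} {lam : ℝ}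

theorem integral_abs_perturbation_le (hv₁ : Integrable v₁) (hd : Integrable d) (h0 : 0 < lam)
    (hdl : ∫ x, |d x| ≤ lam) : ∫ x, |lam * v₁ x + d x| ≤ lam * ((∫ x, |v₁ x|) + 1) := by
  have h : ∫ x, |lam * v₁ x + d x| ≤ ∫ x, (lam * |v₁ x| + |d x|) := by
    refine integral_mono ((hv₁.const_mul lam).add hd).abs ((hv₁.abs.const_mul lam).add hd.abs)
      fun x => (abs_add_le _ _).trans (le_of_eq ?_)
    rw [abs_mul, abs_of_pos h0]
  rw [integral_add (hv₁.abs.const_mul lam) hd.abs, integral_const_mul] at h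
  linarith

theorem integral_abs_potential_le (hv : Integrable v) (hv₁ : Integrable v₁) (hd : Integrable d)
    (h0 : 0 < lam) (h1 : lam ≤ 1) (hdl : ∫ x, |d x| ≤ lam) :
    ∫ x, |lam * (v x + (lam * v₁ x + d x))|
      ≤ lam * ((∫ x, |v x|) + ((∫ x, |v₁ x|) + 1)) := by
  have hp := (hv₁.const_mul lam).fun_add hd
  have hN : 0 ≤ ∫ y, |v₁ y| := integral_nonneg fun _ => abs_nonneg _
  simp only [abs_mul, abs_of_pos h0, integral_const_mul]
  refine mul_le_mul_of_nonneg_left ?_ h0.le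
  calc ∫ x, |v x + (lam * v₁ x + d x)| ≤ ∫ x, (|v x| + |lam * v₁ x + d x|) :=
        integral_mono (hv.add hp).abs (hv.abs.add hp.abs) fun x => abs_add_le _ _
    _ = (∫ x, |v x|) + ∫ x, |lam * v₁ x + d x| := integral_add hv.abs hp.abs
    _ ≤ _ := by
      have := integral_abs_perturbation_le hv₁ hd h0 hdl
      nlinarith

/-- With potential λ(v + λv₁ + d), the linear term gives ½∫v + ½λ∫v₁ up to ½‖d‖₁. The quadratic term
already carries λ², so perturbing v by the O(λ) quantity λv₁ + d changes it only at order λ³. -/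
theorem abs_born_sub_le {R : ℝ} (hR : 0 ≤ R) (hv : Integrable v) (hv₁ : Integrable v₁)
    (hd : Integrable d) (h0 : 0 < lam) (h1 : lam ≤ 1) (hdl : ∫ x, |d x| ≤ lam) :
    |1 / 2 * (∫ x, lam * (v x + (lam * v₁ x + d x)))
        + 1 / 4 * clampEnergy R (fun x => lam * (v x + (lam * v₁ x + d x)))
        - lam * (1 / 2 * (∫ x, v x) + lam * (1 / 4 * clampEnergy R v + 1 / 2 * ∫ x, v₁ x))|
      ≤ lam * (1 / 2 * (∫ x, |d x|) + R / 2 * ((∫ x, |v₁ x|) + 1)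
          * (2 * (∫ x, |v x|) + ((∫ x, |v₁ x|) + 1)) * lam ^ 2) := by
  have hp := (hv₁.const_mul lam).fun_add hd
  have hN : 0 ≤ ∫ y, |v y| := integral_nonneg fun _ => abs_nonneg _
  have hN₁ : 0 ≤ ∫ y, |v₁ y| := integral_nonneg fun _ => abs_nonneg _
  have hP : 0 ≤ ∫ x, |lam * v₁ x + d x| := integral_nonneg fun _ => abs_nonneg _
  have b1 := abs_clampEnergy_add_sub_le hR hv hp
  have b2 := integral_abs_perturbation_le hv₁ hd h0 hdl
  have b3 : |∫ x, d x| ≤ ∫ x, |d x| := abs_integral_le_integral_abs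
  have b4 : 2 * R * (∫ x, |lam * v₁ x + d x|) * (2 * (∫ x, |v x|) + ∫ x, |lam * v₁ x + d x|)
      ≤ 2 * R * (lam * ((∫ x, |v₁ x|) + 1)) * (2 * (∫ x, |v x|) + ((∫ x, |v₁ x|) + 1)) := by
    refine mul_le_mul (mul_le_mul_of_nonneg_left b2 (by positivity)) ?_ (by positivity)
      (by positivity)
    nlinarith
  have e1 : ∫ x, lam * (v x + (lam * v₁ x + d x))
      = lam * ((∫ x, v x) + (lam * (∫ x, v₁ x) + ∫ x, d x)) := by
    rw [integral_const_mul, integral_add hv hp, integral_add (hv₁.const_mul lam) hd,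
      integral_const_mul]
  rw [e1, clampEnergy_const_mul]
  set E := clampEnergy R fun x => v x + (lam * v₁ x + d x) with hE
  have b5 := b1.trans b4
  have e2 : 1 / 2 * (lam * ((∫ x, v x) + (lam * (∫ x, v₁ x) + ∫ x, d x))) + 1 / 4 * (lam ^ 2 * E)
      - lam * (1 / 2 * (∫ x, v x) + lam * (1 / 4 * clampEnergy R v + 1 / 2 * ∫ x, v₁ x))
      = lam * (1 / 2 * (∫ x, d x) + lam * (1 / 4 * (E - clampEnergy R v))) := by ring
  rw [e2, abs_mul, abs_of_pos h0]
  refine mul_le_mul_of_nonneg_left ((abs_add_le _ _).trans (add_le_add ?_ ?_)) h0.le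
  · rw [abs_mul, abs_of_pos (by norm_num : (0 : ℝ) < 1 / 2)]
    linarith
  · rw [abs_mul, abs_mul, abs_of_pos h0, abs_of_pos (by norm_num : (0 : ℝ) < 1 / 4)]
    have := mul_le_mul_of_nonneg_left (mul_le_mul_of_nonneg_left b5
      (by norm_num : (0 : ℝ) ≤ 1 / 4)) h0.le
    refine this.trans (le_of_eq ?_)
    ring

end Expansion

theorem ae_eq_expansion (V V₁ W : LInf) (lam : ℝ) :
    ((lam • W : LInf) : ℝ → ℝ) =ᵐ[volume]
      fun x => lam * (V x + (lam * V₁ x + (W - V - lam • V₁ : LInf) x)) := by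
  filter_upwards [Lp.coeFn_smul lam W, Lp.coeFn_sub (W - V) (lam • V₁), Lp.coeFn_sub W V,
    Lp.coeFn_smul lam V₁] with x h1 h2 h3 h4
  rw [h1, h2, Pi.sub_apply, h3, h4]
  simp

theorem SupportedIn.smul {q : LInf} {R : ℝ} (h : SupportedIn q R) (c : ℝ) :
    SupportedIn (c • q) R := by
  filter_upwards [h, Lp.coeFn_smul c q] with x hx h1 hR
  rw [h1, Pi.smul_apply, hx hR, smul_zero]

theorem SupportedIn.sub {q p : LInf} {R : ℝ} (h : SupportedIn q R) (h' : SupportedIn p R) :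
    SupportedIn (q - p) R := by
  filter_upwards [h, h', Lp.coeFn_sub q p] with x hx hx' h1 hR
  rw [h1, Pi.sub_apply, hx hR, hx' hR, sub_zero]

/-- The remainder constant in the expansion of the square root of the binding energy. -/
def remainderConst (R : ℝ) (V V₁ : LInf) : ℝ :=
  R / 2 * ((∫ x, |V₁ x|) + 1) * (2 * (∫ x, |V x|) + ((∫ x, |V₁ x|) + 1))
    + 4 * R ^ 2 * ((∫ x, |V x|) + ((∫ x, |V₁ x|) + 1)) ^ 3

theorem exists_momentum_expansion {R lam : ℝ} (hR : 0 ≤ R) {V V₁ W : LInf}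
    (hV : SupportedIn V R) (hV₁ : SupportedIn V₁ R) (hW : SupportedIn W R)
    (h0 : 0 < lam) (h1 : lam ≤ 1)
    (hdl : ∫ x, |(W - V - lam • V₁ : LInf) x| ≤ lam)
    (hs₁ : 2 * R * (lam * ((∫ x, |V x|) + ((∫ x, |V₁ x|) + 1))) ≤ 1)
    (hs₂ : R * (lam * ((∫ x, |V x|) + ((∫ x, |V₁ x|) + 1)))
      + 2 * R ^ 2 * (lam * ((∫ x, |V x|) + ((∫ x, |V₁ x|) + 1))) ^ 2 < 1) :
    ∃ κ : ℝ, (0 < κ → IsEigenvalue (schrodinger (lam • W)) ((-κ ^ 2 : ℝ) : ℂ)) ∧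
      |κ + lam * (omega0 V + lam * omega1 V V₁)| ≤
        lam * (1 / 2 * (∫ x, |(W - V - lam • V₁ : LInf) x|) + remainderConst R V V₁ * lam ^ 2) := by
  have hd := ((hW.sub hV).sub (hV₁.smul lam)).integrable
  have hq := hW.smul lam
  have hqe := ae_eq_expansion V V₁ W lam
  set M := (∫ x, |V x|) + ((∫ x, |V₁ x|) + 1) with hM
  have hN : 0 ≤ ∫ x, |(lam • W : LInf) x| := integral_nonneg fun _ => abs_nonneg _
  have hNM : ∫ x, |(lam • W : LInf) x| ≤ lam * M := by
    have e : ∫ x, |(lam • W : LInf) x|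
        = ∫ x, |lam * (V x + (lam * V₁ x + (W - V - lam • V₁ : LInf) x))| := by
      refine integral_congr_ae ?_
      filter_upwards [hqe] with x hx
      rw [hx]
    rw [e]
    exact integral_abs_potential_le hV.integrable hV₁.integrable hd h0 h1 hdl
  obtain ⟨κ, ψ, hκ, hψ, hb⟩ := exists_momentum hR hq.integrable
    ((mul_le_mul_of_nonneg_left hNM (by positivity)).trans hs₁)
    ((add_le_add (mul_le_mul_of_nonneg_left hNM hR) (mul_le_mul_of_nonneg_left
      (pow_le_pow_left₀ hN hNM 2) (by positivity))).trans_lt hs₂)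
  refine ⟨κ, fun hpos => isEigenvalue_of_reduced hq hq.integrable hpos hκ hψ, ?_⟩
  have b1 := hb.trans (mul_le_mul_of_nonneg_left (pow_le_pow_left₀ hN hNM 3)
    (by positivity : 0 ≤ 4 * R ^ 2))
  have b2 := abs_born_sub_le hR hV.integrable hV₁.integrable hd h0 h1 hdl
  rw [integral_congr_ae hqe, clampEnergy_congr hqe] at b1
  rw [omega0, omega1, hV.doubleIntegral_eq hR, remainderConst, ← hM]
  rw [abs_le] at b1 b2 ⊢
  -- The two errors add up: the cubic remainder of the fixed point and the remainder of the Born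
  -- terms.
  constructor <;> nlinarith only [b1.1, b1.2, b2.1, b2.2]

/-! ### Squared and square-root forms of the asymptotics. -/

/-- Because ω₀ < 0, the bracket ω₀ + λω₁ + o(λ) is eventually negative, so the root of its square is
its negative. The two remainders differ by the factor -λ. -/
theorem hasThresholdExpansion_iff {e : ℝ → ℝ} {ω₀ ω₁ : ℝ} (hω₀ : ω₀ < 0) :
    HasThresholdExpansion e ω₀ ω₁ ↔
      (fun lam : ℝ => Real.sqrt (-e lam) - (-(lam * ω₀) - lam ^ 2 * ω₁))
        =o[𝓝[>] 0] fun lam : ℝ => lam ^ 2 := by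
  have hid : Tendsto (fun lam : ℝ => lam) (𝓝[>] 0) (𝓝 0) :=
    tendsto_nhdsWithin_of_tendsto_nhds tendsto_id
  have hpos : ∀ᶠ lam : ℝ in 𝓝[>] 0, 0 < lam := eventually_mem_nhdsWithin
  have hlt : ∀ {r : ℝ → ℝ}, r =o[𝓝[>] 0] (fun lam : ℝ => lam) →
      ∀ᶠ lam in 𝓝[>] (0 : ℝ), ω₀ + lam * ω₁ + r lam < 0 := fun {r} hr => by
    have hr0 : Tendsto r (𝓝[>] 0) (𝓝 0) := hr.isBigO.trans_tendsto hid
    have := ((tendsto_const_nhds (x := ω₀)).add (hid.mul_const ω₁)).add hr0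
    rw [zero_mul, add_zero, add_zero] at this
    exact this.eventually_lt_const hω₀
  constructor
  · rintro ⟨r, hr, he⟩
    have h1 := (isBigO_refl (fun lam : ℝ => lam) (𝓝[>] 0)).neg_left.mul_isLittleO hr
    refine h1.congr' ?_ ?_
    · filter_upwards [he, hlt hr, hpos] with lam h2 h3 h4
      have h5 : -e lam = (-(lam * (ω₀ + lam * ω₁ + r lam))) ^ 2 := by rw [h2]; ring
      rw [h5, Real.sqrt_sq (by nlinarith)]
      ring
    · exact Eventually.of_forall fun lam => by ring
  · intro h
    set s := fun lam : ℝ => Real.sqrt (-e lam) - (-(lam * ω₀) - lam ^ 2 * ω₁) with hs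
    have hr : (fun lam => -(lam⁻¹ * s lam)) =o[𝓝[>] 0] (fun lam : ℝ => lam) := by
      refine IsLittleO.neg_left ?_
      refine ((isBigO_refl (fun lam : ℝ => lam⁻¹) (𝓝[>] 0)).mul_isLittleO h).congr'
        EventuallyEq.rfl ?_
      filter_upwards [hpos] with lam h4
      field_simp
    refine ⟨_, hr, ?_⟩
    filter_upwards [hlt hr, hpos] with lam h3 h4
    have h5 : Real.sqrt (-e lam) = -(lam * (ω₀ + lam * ω₁ + -(lam⁻¹ * s lam))) := by
      rw [hs]
      field_simp
      ring
    -- `Real.sqrt` vanishes on negative numbers, so positivity of the root is what guarantees -e > 0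
    -- and lets squaring recover e.
    have h6 : 0 < Real.sqrt (-e lam) := by rw [h5]; nlinarith
    have h7 := Real.sq_sqrt (Real.sqrt_pos.1 h6).le
    rw [h5] at h7
    linarith

/-! ### Existence of the eigenvalue and the main theorem. -/

theorem exists_eigenvalue_expansion
    (V V₁ : LInf) (Vfam : ℝ → LInf) {R : ℝ} (hR : 0 ≤ R)
    (hV : SupportedIn V R) (hV₁ : SupportedIn V₁ R)
    (hVfam : ∀ᶠ lam in 𝓝[>] (0 : ℝ), SupportedIn (Vfam lam) R)
    (happrox : (fun lam : ℝ => ∫ x, |(Vfam lam - V - lam • V₁ : LInf) x|)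
      =o[𝓝[>] 0] (fun lam : ℝ => lam))
    (hneg : omega0 V < 0) :
    ∃ e : ℝ → ℝ,
      (∀ᶠ lam in 𝓝[>] (0 : ℝ), e lam < 0 ∧
        IsEigenvalue (schrodinger (lam • Vfam lam)) (e lam : ℂ)) ∧
      HasThresholdExpansion e (omega0 V) (omega1 V V₁) := by
  have hid : Tendsto (fun lam : ℝ => lam) (𝓝[>] 0) (𝓝 0) :=
    tendsto_nhdsWithin_of_tendsto_nhds tendsto_id
  have hpos : ∀ᶠ lam : ℝ in 𝓝[>] 0, 0 < lam := eventually_mem_nhdsWithin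
  set n := fun lam : ℝ => ∫ x, |(Vfam lam - V - lam • V₁ : LInf) x| with hn
  have hn0 : Tendsto n (𝓝[>] 0) (𝓝 0) := happrox.isBigO.trans_tendsto hid
  set M := (∫ x, |V x|) + ((∫ x, |V₁ x|) + 1) with hM
  set C := remainderConst R V V₁ with hC
  have hδ : (fun lam => 1 / 2 * n lam + C * lam ^ 2) =o[𝓝[>] 0] (fun lam : ℝ => lam) := by
    refine (happrox.const_mul_left _).add (IsLittleO.const_mul_left ?_ _)
    have h1 : (fun lam : ℝ => lam) =o[𝓝[>] 0] (fun _ : ℝ => (1 : ℝ)) :=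
      (isLittleO_one_iff ℝ).2 hid
    simpa [sq] using h1.mul_isBigO (isBigO_refl (fun lam : ℝ => lam) (𝓝[>] 0))
  have hδ0 : Tendsto (fun lam => 1 / 2 * n lam + C * lam ^ 2) (𝓝[>] 0) (𝓝 0) :=
    hδ.isBigO.trans_tendsto hid
  have hlM : Tendsto (fun lam : ℝ => lam * M) (𝓝[>] 0) (𝓝 0) := by
    simpa using hid.mul_const M
  have hs₁ : ∀ᶠ lam in 𝓝[>] (0 : ℝ), 2 * R * (lam * M) ≤ 1 := by
    have := hlM.const_mul (2 * R)
    rw [mul_zero] at this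
    exact this.eventually_le_const zero_lt_one
  have hs₂ : ∀ᶠ lam in 𝓝[>] (0 : ℝ), R * (lam * M) + 2 * R ^ 2 * (lam * M) ^ 2 < 1 := by
    have := (hlM.const_mul R).add ((hlM.pow 2).const_mul (2 * R ^ 2))
    rw [mul_zero, zero_pow two_ne_zero, mul_zero, add_zero] at this
    exact this.eventually_lt_const zero_lt_one
  have hlead : ∀ᶠ lam in 𝓝[>] (0 : ℝ),
      omega0 V + lam * omega1 V V₁ + (1 / 2 * n lam + C * lam ^ 2) < 0 := by
    have := ((tendsto_const_nhds (x := omega0 V)).add (hid.mul_const (omega1 V V₁))).add hδ0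
    rw [zero_mul, add_zero, add_zero] at this
    exact this.eventually_lt_const hneg
  have hex : ∀ᶠ lam in 𝓝[>] (0 : ℝ), ∃ κ : ℝ, 0 < κ ∧
      IsEigenvalue (schrodinger (lam • Vfam lam)) ((-κ ^ 2 : ℝ) : ℂ) ∧
      |κ + lam * (omega0 V + lam * omega1 V V₁)| ≤ lam * (1 / 2 * n lam + C * lam ^ 2) := by
    filter_upwards [hpos, hid.eventually_le_const zero_lt_one, hVfam, hs₁, hs₂, hlead,
      happrox.bound zero_lt_one] with lam h0 h1 hW h2 h3 h4 h5
    rw [one_mul, Real.norm_of_nonneg h0.le] at h5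
    obtain ⟨κ, hκ, hb⟩ := exists_momentum_expansion hR hV hV₁ hW h0 h1
      ((le_abs_self _).trans h5) h2 h3
    -- The error bound gives κ ≥ -λ(ω₀ + λω₁ + δ), where δ = ½n + Cλ², and this is positive by
    -- `hlead`.
    have hκ0 : 0 < κ := by
      have := (abs_le.1 hb).1
      nlinarith
    exact ⟨κ, hκ0, hκ hκ0, hb⟩
  obtain ⟨κ, hκ⟩ := hex.choice
  refine ⟨fun lam => -κ lam ^ 2, ?_, ?_⟩
  · filter_upwards [hκ] with lam h
    exact ⟨neg_neg_of_pos (pow_pos h.1 2), h.2.1⟩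
  -- The remainder is chosen so that ω₀ + λω₁ + r = -κ/λ exactly.
  · refine ⟨fun lam => -(lam⁻¹ * (κ lam + lam * (omega0 V + lam * omega1 V V₁))), ?_, ?_⟩
    · refine IsBigO.trans_isLittleO (IsBigO.of_bound 1 ?_) hδ
      filter_upwards [hκ, hpos] with lam h h0
      rw [norm_neg, norm_mul, norm_inv, Real.norm_of_nonneg h0.le, one_mul]
      rw [inv_mul_le_iff₀ h0]
      exact h.2.2.trans (mul_le_mul_of_nonneg_left (le_abs_self _) h0.le)
    · filter_upwards [hpos] with lam h0
      field_simp
      ring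

end WeakCoupling

end

theorem corollary2
    (V V₁ : WeakCoupling.LInf) (Vfam : ℝ → WeakCoupling.LInf) (ℓ : ℝ)
    -- compact supports, uniformly for small positive values of the coupling constant
    (hV : WeakCoupling.SupportedIn V ℓ) (hV₁ : WeakCoupling.SupportedIn V₁ ℓ)
    (hVfam : ∀ᶠ lam in 𝓝[>] (0 : ℝ), WeakCoupling.SupportedIn (Vfam lam) ℓ)
    -- `V_lam = V + lam V₁ + o(lam)` in the norm of `L₂(ℝ)`
    (happrox : (fun lam : ℝ => (eLpNorm (Vfam lam - V - lam • V₁ : WeakCoupling.LInf)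
        2 (volume : Measure ℝ)).toReal) =o[𝓝[>] 0] (fun lam : ℝ => lam))
    (hneg : ∫ x, V x < 0) :
    (∃ e : ℝ → ℝ,
      (∀ᶠ lam in 𝓝[>] (0 : ℝ), e lam < 0 ∧
        WeakCoupling.IsEigenvalue (WeakCoupling.schrodinger (lam • Vfam lam)) (e lam : ℂ)) ∧
      WeakCoupling.HasThresholdExpansion e
        (WeakCoupling.omega0 V) (WeakCoupling.omega1 V V₁)) ∧
    ((∀ᶠ lam in 𝓝[>] (0 : ℝ), Vfam lam = V) →
      ∀ e : ℝ → ℝ,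
        WeakCoupling.HasThresholdExpansion e
            (WeakCoupling.omega0 V) (WeakCoupling.omega1 V V₁) ↔
          WeakCoupling.HasACGExpansion e V) := by
  have hω₀ : WeakCoupling.omega0 V < 0 := by
    rw [WeakCoupling.omega0]
    linarith
  -- The sign of ℓ is not prescribed, while truncation needs a nonnegative radius; hence |ℓ|.
  replace hV := hV.mono (le_abs_self ℓ)
  replace hV₁ := hV₁.mono (le_abs_self ℓ)
  replace hVfam := hVfam.mono fun lam h => h.mono (le_abs_self ℓ)
  have hL1 : (fun lam : ℝ => ∫ x, |(Vfam lam - V - lam • V₁ : WeakCoupling.LInf) x|)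
      =o[𝓝[>] 0] (fun lam : ℝ => lam) := by
    refine IsBigO.trans_isLittleO (IsBigO.of_bound (volume (Set.Icc (-|ℓ|) |ℓ|)
      ^ (1 / (1 : ℝ≥0∞).toReal - 1 / (2 : ℝ≥0∞).toReal)).toReal ?_) happrox
    filter_upwards [hVfam] with lam h
    have h1 := ((h.sub hV).sub (hV₁.smul lam)).integral_abs_le
    rw [mul_comm] at h1
    rw [Real.norm_of_nonneg (integral_nonneg fun _ => abs_nonneg _),
      Real.norm_of_nonneg ENNReal.toReal_nonneg]
    exact h1
  refine ⟨WeakCoupling.exists_eigenvalue_expansion V V₁ Vfam (abs_nonneg ℓ) hV hV₁ hVfam hL1 hω₀,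
    fun hconst e => ?_⟩
  -- A constant family leaves λ‖V₁‖₁ = o(λ), so ‖V₁‖₁ = 0 and the V₁ term drops out of ω₁.
  have hV₁0 : ∫ x, V₁ x = 0 := by
    have h1 : (fun lam : ℝ => lam * ∫ x, |V₁ x|) =o[𝓝[>] 0] (fun lam : ℝ => lam * 1) := by
      refine hL1.congr' ?_ (Eventually.of_forall fun lam => (mul_one lam).symm)
      filter_upwards [hconst, eventually_mem_nhdsWithin] with lam h h0
      rw [h, ← integral_const_mul]
      refine integral_congr_ae ?_
      filter_upwards [Lp.coeFn_sub (V - V) (lam • V₁), Lp.coeFn_sub V V, Lp.coeFn_smul lam V₁]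
        with x a b c
      rw [a, Pi.sub_apply, b, c]
      simp [abs_mul, abs_of_pos (Set.mem_Ioi.1 h0)]
    have h2 : (fun _ : ℝ => ∫ x, |V₁ x|) =o[𝓝[>] 0] (fun _ : ℝ => (1 : ℝ)) := by
      refine ((isBigO_refl (fun lam : ℝ => lam⁻¹) (𝓝[>] 0)).mul_isLittleO h1).congr' ?_ ?_ <;>
      · filter_upwards [eventually_mem_nhdsWithin] with lam h0
        rw [inv_mul_cancel_left₀ (Set.mem_Ioi.1 h0).ne']
    have h3 : ∫ x, |V₁ x| = 0 :=
      tendsto_nhds_unique tendsto_const_nhds ((isLittleO_one_iff ℝ).1 h2)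
    have h4 := abs_integral_le_integral_abs (f := V₁) (μ := volume)
    rw [h3] at h4
    exact abs_nonpos_iff.1 h4
  rw [WeakCoupling.hasThresholdExpansion_iff hω₀, WeakCoupling.HasACGExpansion,
    WeakCoupling.omega0, WeakCoupling.omega1, hV₁0]
  refine iff_of_eq (congrArg (fun f : ℝ → ℝ => f =o[𝓝[>] 0] fun lam : ℝ => lam ^ 2) ?_)
  funext lam
  ring
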